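/- A hypergraph $H$ consists of a finite vertex set $V(H)$ and a set $E(H)\subseteq 2^{V(H)}$ of edges. For $X\subseteq V(H)$ let $H-X$ be the hypergraph with vertex set $V(H)\setminus X$ and edge set $\{e\setminus X : e\in E(H)\}\setminus\{\emptyset\}$. A nest-set of $H$ is a non-empty set $s\subseteq V(H)$ such that $\{e\setminus s : e\in E(H),\ e\cap s\neq\emptyset\}$ is linearly ordered by $\subseteq$. A $k$-nest-set elimination ordering of $H$ is a sequence $(s_1,\dots,s_q)$ such that, with $H_0=H$ and $H_i=H_{i-1}-s_i$, each $s_i$ is a nest-set of $H_{i-1}$ with $|s_i|\le k$, and $H_q$ has no vertices. The nest-set width $\mathrm{nsw}(H)$ is the least $k$ for which such an ordering exists. For a propositional formula $F$ in conjunctive normal form (CNF), $H(F)$ is the hypergraph whose vertices are the variables occurring in $F$ and whose edges are the sets of variables of the clauses of $F$; put $\mathrm{nsw}(F)=\mathrm{nsw}(H(F))$. Let $|F|$ be the length of $F$ written as a word over a finite alphabet, with variables named by natural numbers in binary. **Theorem.** SAT for propositional CNF formulas is fixed-parameter tractable when parameterized by the nest-set width of the formula. That is, there are a computable function $f:\mathbb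 N\to\mathbb N$, a constant $c\in\mathbb N$ and a deterministic (multi-stack) Turing machine which, given any CNF formula $F$ (without the value $\mathrm{nsw}(F)$), decides whether $F$ is satisfiable and halts after at most $f(\mathrm{nsw}(F))\cdot(|F|+1)^c$ steps. -/

import Mathlib

namespace NestSetSAT

open scoped Hypergraph

section HypergraphWidth

variable {α : Type*}

/-- The edges of `H` that are incident to at least one vertex of `s`. -/
def incidentEdges (H : Hypergraph α) (s : Set α) : Set (Set α) :=
  {e | e ∈ E(H) ∧ ∃ v ∈ s, v ∈ e}

/-- The vertex-induced subhypergraph on `V(H) \ s`: the vertices of `s` are removed from the vertex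
set and from every edge, and edges that are empty afterwards are dropped. -/
def deleteVertices (H : Hypergraph α) (s : Set α) : Hypergraph α where
  vertexSet := V(H) \ s
  edgeSet := {e | e.Nonempty ∧ ∃ e' ∈ E(H), e = e' ∩ (V(H) \ s)}
  subset_vertexSet_of_mem_edgeSet' := by
    rintro e ⟨-, e', -, rfl⟩
    exact Set.inter_subset_right

/-- A nest-set of `H`: a non-empty set `s` of vertices such that the sets `e \ s`, for `e` an edge
incident to `s`, are linearly ordered by inclusion. -/
def IsNestSet (H : Hypergraph α) (s : Set α) : Prop :=
  s.Nonempty ∧ s ⊆ V(H) ∧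
    IsChain (· ⊆ ·) ((fun e : Set α => e \ s) '' incidentEdges H s)

/-- A nest-set elimination ordering of `H`: a sequence of sets each of which is a nest-set of what
is left of `H` after the deletion of the preceding ones, and which together exhaust the vertices
of `H`. (After at least one deletion no empty edge is left, so having no vertices then means
being the hypergraph without vertices and edges.) -/
def IsNEO (H : Hypergraph α) : List (Set α) → Prop
  | [] => V(H) = ∅
  | s :: O => IsNestSet H s ∧ IsNEO (deleteVertices H s) O

/-- A `k`-NEO: a nest-set elimination ordering all of whose sets have at most `k` elements. -/
def IsKNEO (H : Hypergraph α) (k : ℕ) (O : List (Set α)) : Prop :=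
  IsNEO H O ∧ ∀ s ∈ O, s.encard ≤ k

/-- The nest-set width of `H`: the least `k` for which `H` has a `k`-NEO. Every hypergraph with
finitely many vertices has one, see `exists_isKNEO`. -/
noncomputable def nestSetWidth (H : Hypergraph α) : ℕ :=
  sInf {k : ℕ | ∃ O : List (Set α), IsKNEO H k O}

/-- The set of all vertices is a nest-set, so the width of a finite hypergraph is a genuine
minimum. -/
theorem exists_isKNEO (H : Hypergraph α) (hV : V(H).Finite) :
    ∃ (k : ℕ) (O : List (Set α)), IsKNEO H k O := by
  rcases V(H).eq_empty_or_nonempty with h | h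
  · exact ⟨0, [], h, by simp⟩
  · refine ⟨V(H).ncard, [V(H)], ⟨⟨h, subset_rfl, ?_⟩, ?_⟩, ?_⟩
    · rintro _ ⟨e, he, rfl⟩ _ ⟨e', -, rfl⟩ -
      left
      intro x hx
      exact absurd (H.subset_vertexSet_of_mem_edgeSet' he.1 hx.1) hx.2
    · simp [IsNEO, deleteVertices]
    · simp [hV.cast_ncard_eq]

end HypergraphWidth

section Formulas

/-- A literal: a propositional variable together with its sign (`true` for the variable itself,
`false` for its negation). -/
abbrev Literal : Type := ℕ × Bool

/-- A clause, the disjunction of its literals. -/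
abbrev Clause : Type := List Literal

/-- A propositional formula in conjunctive normal form, the conjunction of its clauses. -/
abbrev CNF : Type := List Clause

/-- The truth assignment `τ` satisfies the formula `F`. -/
def Satisfies (τ : ℕ → Bool) (F : CNF) : Prop :=
  ∀ C ∈ F, ∃ l ∈ C, τ l.1 = l.2

/-- Membership in the language SAT. -/
def Satisfiable (F : CNF) : Prop :=
  ∃ τ : ℕ → Bool, Satisfies τ F

/-- The variables that occur in a clause. -/
def clauseVars (C : Clause) : Set ℕ :=
  {v | ∃ l ∈ C, l.1 = v}

/-- The hypergraph of a formula: its vertices are the variables that occur in the formula, its edges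
are the variable sets of the clauses. -/
def formulaHypergraph (F : CNF) : Hypergraph ℕ where
  vertexSet := {v | ∃ C ∈ F, v ∈ clauseVars C}
  edgeSet := {e | ∃ C ∈ F, e = clauseVars C}
  subset_vertexSet_of_mem_edgeSet' := by
    rintro e ⟨C, hC, rfl⟩ v hv
    exact ⟨C, hC, hv⟩

/-- The nest-set width of a formula. -/
noncomputable def formulaWidth (F : CNF) : ℕ :=
  nestSetWidth (formulaHypergraph F)

/-- The alphabet over which formulas are written down. -/
inductive Symbol : Type
  | positive
  | negative
  | bit (b : Bool)
  | clauseEnd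

/-- A literal is written as its sign followed by the binary digits of its variable. -/
def encodeLiteral (l : Literal) : List Symbol :=
  (if l.2 then Symbol.positive else Symbol.negative) :: (Nat.bits l.1).map Symbol.bit

/-- A clause is written as the sequence of its literals followed by an end marker. -/
def encodeClause (C : Clause) : List Symbol :=
  C.flatMap encodeLiteral ++ [Symbol.clauseEnd]

/-- A formula is written as the sequence of its clauses. The size of a formula is the length of
this word. -/
def encodeCNF (F : CNF) : List Symbol :=
  F.flatMap encodeClause

end Formulas

section Complexity

/-- The decision problem `L` on instances of type `I`, written as words over the alphabet `Γ` by
`enc`, is fixed-parameter tractable with respect to the parameter `κ`: there are a computable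
function `f`, a constant `c` and one Turing machine (with finitely many stacks) which on every
instance `x` halts with the correct answer after at most `f (κ x) * (|enc x| + 1) ^ c` steps. The
machine is given the instance only, not the value of the parameter. -/
def IsFixedParameterTractable {I Γ : Type} (enc : I → List Γ) (L : I → Prop) (κ : I → ℕ) : Prop :=
  ∃ (M : Turing.TM2ComputableAux Γ Bool) (f : ℕ → ℕ) (c : ℕ), Computable f ∧
    ∀ x : I, ∃ answer : Bool, (answer = true ↔ L x) ∧
      Nonempty (Turing.TM2OutputsInTime M.tm
        ((enc x).map M.inputAlphabet.symm)
        (some ([answer].map M.outputAlphabet.symm))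
        (f (κ x) * ((enc x).length + 1) ^ c))

end Complexity

end NestSetSAT

/-!
When a nest-set `s` is eliminated, a restricted clause `D = C \ s` is kept exactly when, for every
sign pattern `a` on `s`, some clause is contained in `a ∪ D`. As the clauses meeting `s` are
linearly ordered outside `s`, this preserves satisfiability. It increases neither the size of the
formula nor its nest-set width, since the remaining hypergraph is a partial trace of the old one.

Small nest-sets are found by branching: if `s` is not a nest-set, there are clauses `C` and `C'`
meeting `s` and variables `x ∈ C \ (C' ∪ s)`, `y ∈ C' \ (C ∪ s)`, and every nest-set containing `s`
contains `x` or `y`. Starting from one variable, at most `2 ^ k` extensions lead to a nest-set of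
size at most `k`. The sizes `k = 1, 2, …` are tried in turn, so the search stops at the width, which
need not be given.

All data are coded as binary trees, written as words on the stacks of a Turing machine, and running
times are obtained from closure properties of the functions on trees that such machines compute
within bounds polynomial in a given complexity.
-/

namespace NestSetSAT

section Programs

open Turing Function

/-- Structured programs acting on finitely many stacks, the stack `k` having the alphabet `Γ k`,
and on a memory of type `σ`. They are the source language for machines of type `FinTM2`. -/
inductive Prog {K : Type} (Γ : K → Type) (σ : Type) : Type
  | push (k : K) (f : σ → Γ k)
  | pop (k : K) (f : σ → Option (Γ k) → σ)
  | load (f : σ → σ)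
  | seq (p q : Prog Γ σ)
  | ite (b : σ → Bool) (p q : Prog Γ σ)
  | loop (b : σ → Bool) (p : Prog Γ σ)

notation:60 p:61 " ;; " q:60 => Prog.seq p q

variable {K : Type} [DecidableEq K] {Γ : K → Type} {σ : Type}

/-- The big-step semantics of programs: `Run p v S n v' S'` says that `p`, started with memory `v`
and stacks `S`, ends after exactly `n` machine steps with memory `v'` and stacks `S'`. -/
inductive Run : Prog Γ σ → σ → (∀ k, List (Γ k)) → ℕ → σ → (∀ k, List (Γ k)) → Prop
  | push (k : K) (f : σ → Γ k) (v S) : Run (.push k f) v S 1 v (update S k (f v :: S k))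
  | pop (k : K) (f : σ → Option (Γ k) → σ) (v S) :
      Run (.pop k f) v S 1 (f v (S k).head?) (update S k (S k).tail)
  | load (f : σ → σ) (v S) : Run (.load f) v S 1 (f v) S
  | seq {p q v S n v₁ S₁ m v₂ S₂} : Run p v S n v₁ S₁ → Run q v₁ S₁ m v₂ S₂ →
      Run (p ;; q) v S (n + m) v₂ S₂
  | ite_true {b : σ → Bool} {p q v S n v' S'} : b v = true → Run p v S n v' S' →
      Run (.ite b p q) v S (n + 1) v' S'
  | ite_false {b : σ → Bool} {p q v S n v' S'} : b v = false → Run q v S n v' S' →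
      Run (.ite b p q) v S (n + 1) v' S'
  | loop_done {b : σ → Bool} {p v S} : b v = false → Run (.loop b p) v S 1 v S
  | loop_step {b : σ → Bool} {p v S n v₁ S₁ m v₂ S₂} : b v = true → Run p v S n v₁ S₁ →
      Run (.loop b p) v₁ S₁ m v₂ S₂ → Run (.loop b p) v S (n + m + 1) v₂ S₂

namespace Prog

/-- The labels of the machine that executes a program: one for each atomic statement and for each
evaluation of a condition. -/
def Label : Prog Γ σ → Type
  | push _ _ => Unit
  | pop _ _ => Unit
  | load _ => Unit
  | p ;; q => Label p ⊕ Label q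
  | ite _ p q => Option (Label p ⊕ Label q)
  | loop _ p => Option (Label p)

instance finite_label (p : Prog Γ σ) : Finite p.Label := by
  induction p with
  | push | pop | load => exact inferInstanceAs (Finite Unit)
  | seq p q => exact inferInstanceAs (Finite (Label p ⊕ Label q))
  | ite _ p q => exact inferInstanceAs (Finite (Option (Label p ⊕ Label q)))
  | loop _ p => exact inferInstanceAs (Finite (Option (Label p)))

/-- The label at which the execution of a program starts. -/
def entry : (p : Prog Γ σ) → Label p
  | push _ _ => ()
  | pop _ _ => ()
  | load _ => ()
  | p ;; _ => Sum.inl (entry p)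
  | ite _ _ _ => none
  | loop _ _ => none

/-- The translation of a program into the statements of a machine with label set `Λ`, into which
the labels of the program are embedded; `exit` is executed when the program has ended. -/
def code {Λ : Type} : (p : Prog Γ σ) → (Label p → Λ) → TM2.Stmt Γ Λ σ → Label p → TM2.Stmt Γ Λ σ
  | push k f, _, exit, _ => .push k f exit
  | pop k f, _, exit, _ => .pop k f exit
  | load f, _, exit, _ => .load f exit
  | p ;; q, emb, _, Sum.inl l =>
    code p (emb ∘ Sum.inl) (.goto fun _ => emb (Sum.inr (entry q))) l
  | _ ;; q, emb, exit, Sum.inr l => code q (emb ∘ Sum.inr) exit l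
  | ite b p q, emb, _, none =>
    .branch b (.goto fun _ => emb (some (Sum.inl (entry p))))
      (.goto fun _ => emb (some (Sum.inr (entry q))))
  | ite _ p _, emb, exit, some (Sum.inl l) => code p (emb ∘ some ∘ Sum.inl) exit l
  | ite _ _ q, emb, exit, some (Sum.inr l) => code q (emb ∘ some ∘ Sum.inr) exit l
  | loop b p, emb, exit, none => .branch b (.goto fun _ => emb (some (entry p))) exit
  | loop _ p, emb, _, some l => code p (emb ∘ some) (.goto fun _ => emb none) l

/-- The machine that executes a program, with input stack `k₀` and output stack `k₁`. -/
noncomputable def machine [Fintype K] [Fintype σ] (k₀ k₁ : K) [Fintype (Γ k₀)] (v₀ : σ)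
    (p : Prog Γ σ) : FinTM2 where
  K := K
  k₀ := k₀
  k₁ := k₁
  Γ := Γ
  Λ := p.Label
  main := p.entry
  ΛFin := .ofFinite _
  σ := σ
  initialState := v₀
  m := p.code id .halt

end Prog

theorem Run.iterate_step {Λ : Type} (M : Λ → TM2.Stmt Γ Λ σ) {p : Prog Γ σ} {v S n v' S'}
    (h : Run p v S n v' S') : ∀ (emb : p.Label → Λ) (exit : TM2.Stmt Γ Λ σ),
    (∀ l, M (emb l) = p.code emb exit l) →
    (flip bind (TM2.step M))^[n] (some ⟨some (emb p.entry), v, S⟩) =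
      some (TM2.stepAux exit v' S') := by
  have step (l : Λ) (v S) : flip bind (TM2.step M) (some ⟨some l, v, S⟩) =
      some (TM2.stepAux (M l) v S) := rfl
  induction h with intro emb exit hM
  | push | pop | load => rw [iterate_one, step, hM]; rfl
  | seq _ _ ihp ihq =>
    rw [Nat.add_comm, iterate_add_apply]
    exact (congrArg _ (ihp (emb ∘ Sum.inl) _ fun l => hM (Sum.inl l))).trans
      (ihq (emb ∘ Sum.inr) exit fun l => hM (Sum.inr l))
  | ite_true hb _ ih =>
    rw [iterate_succ_apply, step, hM]
    simp only [Prog.entry, Prog.code, TM2.stepAux, hb, cond_true]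
    exact ih (emb ∘ some ∘ Sum.inl) exit fun l => hM (some (Sum.inl l))
  | ite_false hb _ ih =>
    rw [iterate_succ_apply, step, hM]
    simp only [Prog.entry, Prog.code, TM2.stepAux, hb, cond_false]
    exact ih (emb ∘ some ∘ Sum.inr) exit fun l => hM (some (Sum.inr l))
  | loop_done hb =>
    rw [iterate_one, step, hM]
    simp only [Prog.entry, Prog.code, TM2.stepAux, hb, cond_false]
  | @loop_step b p v S n v₁ S₁ m v₂ S₂ hb _ _ ihp ihl =>
    rw [iterate_succ_apply, step, hM]
    simp only [Prog.entry, Prog.code, TM2.stepAux, hb, cond_true]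
    rw [Nat.add_comm n m, iterate_add_apply]
    exact (congrArg _ (ihp (emb ∘ some) _ fun l => hM (some l))).trans (ihl emb exit hM)

theorem initList_eq_update (tm : FinTM2) (l : List (tm.Γ tm.k₀)) :
    initList tm l = ⟨some tm.main, tm.initialState, update (fun _ => []) tm.k₀ l⟩ := by
  unfold initList
  congr 1
  funext k
  by_cases hk : k = tm.k₀
  · subst hk; simp
  · simp [hk]

theorem haltList_eq_update (tm : FinTM2) (l : List (tm.Γ tm.k₁)) :
    haltList tm l = ⟨none, tm.initialState, update (fun _ => []) tm.k₁ l⟩ := by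
  unfold haltList
  congr 1
  funext k
  by_cases hk : k = tm.k₁
  · subst hk; simp
  · simp [hk]

theorem Run.outputsInTime [Fintype K] [Fintype σ] {k₀ k₁ : K} [Fintype (Γ k₀)] {v₀ : σ}
    {p : Prog Γ σ} {l : List (Γ k₀)} {l' : List (Γ k₁)} {n m : ℕ}
    (h : Run p v₀ (update (fun _ => []) k₀ l) n v₀ (update (fun _ => []) k₁ l')) (hn : n ≤ m) :
    Nonempty (TM2OutputsInTime (p.machine k₀ k₁ v₀) l (some l') m) := by
  have run := h.iterate_step (p.code id .halt) id .halt fun _ => rfl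
  have start := congrArg some (initList_eq_update (p.machine k₀ k₁ v₀) l)
  have halt := congrArg some (haltList_eq_update (p.machine k₀ k₁ v₀) l')
  exact ⟨⟨⟨n, (congrArg _ start).trans (run.trans halt.symm)⟩, hn⟩⟩

end Programs

section Machine

open Turing Function

/-- `whileProg g b p` runs `g`, and as long as the memory then passes the test `b`, runs `p` and
starts again. -/
def whileProg {K : Type} {Γ : K → Type} {σ : Type} (g : Prog Γ σ) (b : σ → Bool) (p : Prog Γ σ) :
    Prog Γ σ :=
  g ;; .loop b (p ;; g)

theorem Run.while_done {K : Type} [DecidableEq K] {Γ : K → Type} {σ : Type} {g p : Prog Γ σ}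
    {b : σ → Bool} {v S n v' S'} (hg : Run g v S n v' S') (hb : b v' = false) :
    Run (whileProg g b p) v S (n + 1) v' S' :=
  .seq hg (.loop_done hb)

theorem Run.while_step {K : Type} [DecidableEq K] {Γ : K → Type} {σ : Type} {g p : Prog Γ σ}
    {b : σ → Bool} {v S n v₁ S₁ m v₂ S₂ k v₃ S₃} (hg : Run g v S n v₁ S₁) (hb : b v₁ = true)
    (hp : Run p v₁ S₁ m v₂ S₂) (h : Run (whileProg g b p) v₂ S₂ k v₃ S₃) :
    Run (whileProg g b p) v S (n + m + k + 1) v₃ S₃ := by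
  unfold whileProg at h ⊢
  cases h with
  | seq hg' hloop =>
    convert Run.seq hg (.loop_step hb (.seq hp hg') hloop) using 1
    omega

/-- The working stacks: `value` holds the current value, `saved` the values put aside, and the
other two are empty between the basic operations. -/
inductive WorkStack
  | value
  | saved
  | temp
  | temp'
  deriving DecidableEq

instance : Fintype WorkStack :=
  .ofList [.value, .saved, .temp, .temp'] (by rintro ⟨⟩ <;> simp)

/-- The stacks of the machines constructed below. -/
inductive StackName
  | input
  | output
  | work (i : WorkStack)
  deriving DecidableEq, Fintype

/-- The alphabets of the stacks. On the working stacks, `none` separates the saved values. -/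
abbrev Alphabet : StackName → Type
  | .input => Symbol
  | .output => Bool
  | .work _ => Option Bool

instance : Fintype Symbol where
  elems := ⟨↑[Symbol.positive, .negative, .bit false, .bit true, .clauseEnd], by simp⟩
  complete := by rintro (_ | _ | _ | _) <;> simp

/-- The finite memory: two registers for symbols of working stacks (`none` stands for an exhausted
stack), one for a symbol of the input, and a flag. -/
structure Memory where
  first : Option (Option Bool) := none
  second : Option (Option Bool) := none
  read : Option Symbol := none
  flag : Bool := false
  deriving Fintype

/-- Programs over the stacks and the memory fixed above. -/
abbrev StackProg : Type := Prog Alphabet Memory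

/-- The contents of all stacks, given those of the input, the output and the working stacks. -/
def allStacks (I : List Symbol) (O : List Bool) (W : WorkStack → List (Option Bool)) :
    ∀ k, List (Alphabet k)
  | .input => I
  | .output => O
  | .work i => W i

@[simp] theorem update_allStacks_input (I O W I') :
    update (allStacks I O W) .input I' = allStacks I' O W := by
  funext k; cases k <;> simp [allStacks]

@[simp] theorem update_allStacks_output (I O W O') :
    update (allStacks I O W) .output O' = allStacks I O' W := by
  funext k; cases k <;> simp [allStacks]

@[simp] theorem update_allStacks_work (I O W i w) :
    update (allStacks I O W) (.work i) w = allStacks I O (update W i w) := by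
  funext k
  cases k with
  | input | output => simp [allStacks]
  | work j =>
    by_cases h : j = i
    · subst h; simp [allStacks]
    · simp [allStacks, h]

/-- The contents of the working stacks. -/
def workStacks (value saved temp temp' : List (Option Bool)) : WorkStack → List (Option Bool)
  | .value => value
  | .saved => saved
  | .temp => temp
  | .temp' => temp'

section UpdateStacks

variable (a s t u w : List (Option Bool))

@[simp] theorem update_workStacks_value :
    update (workStacks a s t u) .value w = workStacks w s t u := by
  funext k; cases k <;> simp [workStacks]

@[simp] theorem update_workStacks_saved :
    update (workStacks a s t u) .saved w = workStacks a w t u := by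
  funext k; cases k <;> simp [workStacks]

@[simp] theorem update_workStacks_temp :
    update (workStacks a s t u) .temp w = workStacks a s w u := by
  funext k; cases k <;> simp [workStacks]

@[simp] theorem update_workStacks_temp' :
    update (workStacks a s t u) .temp' w = workStacks a s t w := by
  funext k; cases k <;> simp [workStacks]

end UpdateStacks

/-- Pop a working stack into the first register. -/
def popFirst (i : WorkStack) : StackProg := .pop (.work i) fun v x => { v with first := x }

/-- Pop a working stack into the second register. -/
def popSecond (i : WorkStack) : StackProg := .pop (.work i) fun v x => { v with second := x }

/-- Push the symbols of a word on a working stack, so that the word can be read from the top. -/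
def pushWord (i : WorkStack) : List (Option Bool) → StackProg
  | [] => .load id
  | x :: w => pushWord i w ;; .push (.work i) fun _ => x

/-- Push the content of the first register on several working stacks. -/
def putFirst : List WorkStack → StackProg
  | [] => .load id
  | i :: is => putFirst is ;; .push (.work i) fun v => v.first.getD none

theorem run_popFirst {I O W W'} (i v)
    (hW' : W' = update W i (W i).tail := by simp [workStacks]) :
    Run (popFirst i) v (allStacks I O W) 1 { v with first := (W i).head? }
      (allStacks I O W') := by
  have := Run.pop (Γ := Alphabet) (.work i) (fun (v : Memory) x => { v with first := x }) v
    (allStacks I O W)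
  rwa [update_allStacks_work, allStacks, ← hW'] at this

theorem run_popSecond {I O W W'} (i v)
    (hW' : W' = update W i (W i).tail := by simp [workStacks]) :
    Run (popSecond i) v (allStacks I O W) 1 { v with second := (W i).head? }
      (allStacks I O W') := by
  have := Run.pop (Γ := Alphabet) (.work i) (fun (v : Memory) x => { v with second := x }) v
    (allStacks I O W)
  rwa [update_allStacks_work, allStacks, ← hW'] at this

theorem run_pushWord {I O W W'} (i v w)
    (hW' : W' = update W i (w ++ W i) := by simp [workStacks]) :
    Run (pushWord i w) v (allStacks I O W) (w.length + 1) v (allStacks I O W') := by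
  subst hW'
  induction w with
  | nil => simpa [pushWord] using Run.load id v (allStacks I O W)
  | cons x w ih =>
    have := ih.seq (.push (.work i) (fun _ => x) v _)
    rw [update_allStacks_work, update_idem] at this
    simpa [allStacks, pushWord] using this

theorem run_putFirst (I O W is v) (his : is.Nodup) : Run (putFirst is) v (allStacks I O W)
    (is.length + 1) v
    (allStacks I O fun k => if k ∈ is then v.first.getD none :: W k else W k) := by
  induction is with
  | nil => simpa [putFirst] using Run.load id v (allStacks I O W)
  | cons i is ih =>
    obtain ⟨hi, his⟩ := List.nodup_cons.1 his
    have := (ih his).seq (.push (.work i) (fun v => v.first.getD none) v _)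
    rw [update_allStacks_work] at this
    unfold putFirst
    convert this using 1
    · rfl
    · refine congrArg (allStacks I O) (funext fun k => ?_)
      by_cases hk : k = i <;> simp [allStacks, hk, hi]

/-- `Runs p W W' n`: with any initial memory and with the input and the output stack empty, `p`
leads from the working stacks `W` to `W'` in at most `n` steps. -/
def Runs (p : StackProg) (W W' : WorkStack → List (Option Bool)) (n : ℕ) : Prop :=
  ∀ v, ∃ m ≤ n, ∃ v', Run p v (allStacks [] [] W) m v' (allStacks [] [] W')

theorem Runs.mono {p : StackProg} {W W' n m} (h : Runs p W W' n) (hnm : n ≤ m) : Runs p W W' m :=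
  fun v =>
    let ⟨k, hk, run⟩ := h v
    ⟨k, hk.trans hnm, run⟩

theorem Runs.seq {p q : StackProg} {W₀ W₁ W₂ n m} (hp : Runs p W₀ W₁ n) (hq : Runs q W₁ W₂ m) :
    Runs (p ;; q) W₀ W₂ (n + m) := fun v => by
  obtain ⟨k, hk, v₁, run₁⟩ := hp v
  obtain ⟨l, hl, v₂, run₂⟩ := hq v₁
  exact ⟨k + l, by omega, v₂, .seq run₁ run₂⟩

theorem runs_nop (W) : Runs (.load id) W W 1 := fun _ => ⟨1, le_rfl, _, .load ..⟩

theorem runs_popFirst {W W'} (i) (hW' : W' = update W i (W i).tail := by simp [workStacks]) :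
    Runs (popFirst i) W W' 1 := fun _ =>
  ⟨1, le_rfl, _, run_popFirst _ _ hW'⟩

theorem runs_pushWord {W W'} (i w)
    (hW' : W' = update W i (w ++ W i) := by simp [workStacks]) :
    Runs (pushWord i w) W W' (w.length + 1) := fun _ =>
  ⟨_, le_rfl, _, run_pushWord _ _ _ hW'⟩

/-- Pop a working stack down to and including the next separator, pushing every symbol on each of
the stacks `js`. -/
def drain (i : WorkStack) (js : List WorkStack) : StackProg :=
  whileProg (popFirst i) (fun v => v.first.join.isSome) (putFirst js)

theorem runs_drain {W W' : WorkStack → List (Option Bool)} {i : WorkStack} {js : List WorkStack}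
    (l r : List (Option Bool)) (hi : i ∉ js := by decide) (hjs : js.Nodup := by decide)
    (hl : none ∉ l := by simp) (hr : r.head?.join = none := by simp)
    (hW : W i = l ++ r := by simp [workStacks])
    (hW' : W' = (fun k => if k = i then r.tail else if k ∈ js then l.reverse ++ W k else W k) := by
      funext k; cases k <;> simp [workStacks]) :
    Runs (drain i js) W W' ((js.length + 3) * l.length + 2) := fun v => by
  induction l generalizing W v with
  | nil =>
    have hpop := run_popFirst (I := []) (O := []) (W := W) (W' := W') i v <| by
      subst hW'; funext k; by_cases hk : k = i <;> simp [hk, hW]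
    exact ⟨2, by simp, _, .while_done hpop (by simpa [hW] using hr)⟩
  | cons x l ih =>
    obtain ⟨hx, hl'⟩ := not_or.1 (mt List.mem_cons.2 hl)
    obtain ⟨b, rfl⟩ := Option.ne_none_iff_exists'.1 (Ne.symm hx)
    have hpop := run_popFirst (I := []) (O := []) (W := W) i v rfl
    have hput := run_putFirst [] [] (update W i (W i).tail) js
      { v with first := (W i).head? } hjs
    obtain ⟨n, hn, v', run⟩ := ih hl' (by simp [hi, hW]) (W := fun k =>
      if k ∈ js then (W i).head?.getD none :: update W i (W i).tail k
        else update W i (W i).tail k) (by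
        subst hW'; funext k
        by_cases hk : k = i
        · simp [hk]
        · by_cases hk' : k ∈ js <;> simp [hk, hk', hW]) { v with first := (W i).head? }
    refine ⟨_, ?_, v', .while_step hpop (by simp [hW]) hput run⟩
    rw [List.length_cons, Nat.mul_succ]
    omega

end Machine

section Trees

open Turing Function
open scoped BinaryTree

/-- The prefix code of a binary tree, as a word on a working stack. -/
def word : BinaryTree Unit → List (Option Bool)
  | .nil => [some false]
  | .node _ x y => some true :: (word x ++ word y)

/-- The size of a tree: the length of its code. -/
def size (x : BinaryTree Unit) : ℕ := (word x).length

@[simp] theorem size_nil : size .nil = 1 := rfl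

@[simp] theorem size_node (u : Unit) (x y : BinaryTree Unit) :
    size (.node u x y) = size x + size y + 1 := by
  simp [size, word]

@[simp] theorem length_word (x : BinaryTree Unit) : (word x).length = size x := rfl

theorem size_pos (x : BinaryTree Unit) : 0 < size x := by cases x <;> simp

@[simp] theorem none_notMem_word (x : BinaryTree Unit) : none ∉ word x := by
  induction x with
  | nil => simp [word]
  | node _ x y hx hy => simp [word, hx, hy]

theorem word_append_inj {x y : BinaryTree Unit} {l l' : List (Option Bool)}
    (h : word x ++ l = word y ++ l') : x = y ∧ l = l' := by
  induction x generalizing y l l' with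
  | nil => cases y with
    | nil => simpa [word] using h
    | node => simp [word] at h
  | node _ a b ha hb => cases y with
    | nil => simp [word] at h
    | node _ c d =>
      simp only [word, List.cons_append, List.append_assoc, List.cons.injEq, true_and] at h
      obtain ⟨rfl, hbd⟩ := ha h
      obtain ⟨rfl, hl⟩ := hb hbd
      exact ⟨rfl, hl⟩

theorem word_injective : Injective word := fun _ _ h =>
  (word_append_inj (congrArg (· ++ []) h)).1

section Saving

variable (R : List (Option Bool)) (x y : BinaryTree Unit)

/-- Put a copy of the current value aside. -/
def save : StackProg :=
  drain .value [.temp] ;; pushWord .saved [none] ;; drain .temp [.value, .saved]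

theorem runs_save : Runs save (workStacks (word x) R [] [])
    (workStacks (word x) (word x ++ none :: R) [] []) (9 * size x + 6) := by
  have h₁ : Runs (drain .value [.temp]) (workStacks (word x) R [] [])
    (workStacks [] R (word x).reverse []) _ := runs_drain (word x) []
  have h₂ : Runs (pushWord .saved [none]) (workStacks [] R (word x).reverse [])
    (workStacks [] (none :: R) (word x).reverse []) _ := runs_pushWord _ _
  have h₃ : Runs (drain .temp [.value, .saved]) (workStacks [] (none :: R) (word x).reverse [])
    (workStacks (word x) (word x ++ none :: R) [] []) _ := runs_drain (word x).reverse []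
  exact (h₁.seq (h₂.seq h₃)).mono (by
    simp only [List.length_cons, List.length_nil, length_word, List.length_reverse]
    omega)

/-- Take back the value put aside last. -/
def restore : StackProg := drain .saved [.temp] ;; drain .temp [.value]

theorem runs_restore : Runs restore (workStacks [] (word x ++ none :: R) [] [])
    (workStacks (word x) R [] []) (8 * size x + 4) := by
  have h₁ : Runs (drain .saved [.temp]) (workStacks [] (word x ++ none :: R) [] [])
    (workStacks [] R (word x).reverse []) _ := runs_drain (word x) (none :: R)
  have h₂ : Runs (drain .temp [.value]) (workStacks [] R (word x).reverse [])
    (workStacks (word x) R [] []) _ := runs_drain (word x).reverse []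
  exact (h₁.seq h₂).mono (by
    simp only [List.length_cons, List.length_nil, length_word, List.length_reverse]
    omega)

/-- Exchange the current value and the one put aside last. -/
def swap : StackProg :=
  drain .value [.temp] ;; drain .saved [.temp'] ;; pushWord .saved [none] ;;
    drain .temp [.saved] ;; drain .temp' [.value]

theorem runs_swap : Runs swap (workStacks (word y) (word x ++ none :: R) [] [])
    (workStacks (word x) (word y ++ none :: R) [] []) (8 * size x + 8 * size y + 10) := by
  have h₁ : Runs (drain .value [.temp]) (workStacks (word y) (word x ++ none :: R) [] [])
    (workStacks [] (word x ++ none :: R) (word y).reverse []) _ := runs_drain (word y) []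
  have h₂ : Runs (drain .saved [.temp'])
    (workStacks [] (word x ++ none :: R) (word y).reverse [])
    (workStacks [] R (word y).reverse (word x).reverse) _ := runs_drain (word x) (none :: R)
  have h₃ : Runs (pushWord .saved [none])
    (workStacks [] R (word y).reverse (word x).reverse)
    (workStacks [] (none :: R) (word y).reverse (word x).reverse) _ := runs_pushWord _ _
  have h₄ : Runs (drain .temp [.saved])
    (workStacks [] (none :: R) (word y).reverse (word x).reverse)
    (workStacks [] (word y ++ none :: R) [] (word x).reverse) _ := runs_drain (word y).reverse []
  have h₅ : Runs (drain .temp' [.value]) (workStacks [] (word y ++ none :: R) [] (word x).reverse)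
    (workStacks (word x) (word y ++ none :: R) [] []) _ := runs_drain (word x).reverse []
  exact (h₁.seq (h₂.seq (h₃.seq (h₄.seq h₅)))).mono (by
    simp only [List.length_cons, List.length_nil, length_word, List.length_reverse]
    omega)

/-- Pair the value put aside last with the current value. -/
def join : StackProg :=
  drain .saved [.temp] ;; drain .temp [.value] ;; pushWord .value [some true]

theorem runs_join : Runs join (workStacks (word y) (word x ++ none :: R) [] [])
    (workStacks (word (x △ y)) R [] []) (8 * size x + 6) := by
  have h₁ : Runs (drain .saved [.temp]) (workStacks (word y) (word x ++ none :: R) [] [])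
    (workStacks (word y) R (word x).reverse []) _ := runs_drain (word x) (none :: R)
  have h₂ : Runs (drain .temp [.value]) (workStacks (word y) R (word x).reverse [])
    (workStacks (word x ++ word y) R [] []) _ := runs_drain (word x).reverse []
  have h₃ : Runs (pushWord .value [some true]) (workStacks (word x ++ word y) R [] [])
    (workStacks (word (x △ y)) R [] []) _ := runs_pushWord _ _ (by simp [workStacks, word])
  exact (h₁.seq (h₂.seq h₃)).mono (by
    simp only [List.length_cons, List.length_nil, length_word, List.length_reverse]
    omega)

end Saving

section Splitting

variable (R A T C : List (Option Bool))

/-- Move a symbol of a prefix code from the value to `temp`. The height of `temp'` is the number of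
trees whose code is still to be read. -/
def moveSymbol : StackProg :=
  popFirst .value ;; putFirst [.temp] ;;
    .ite (fun v => v.first == some (some true)) (pushWord .temp' [none, none]) (.load id)

/-- Move symbols of prefix codes as long as there are trees to be read. -/
def moveTrees : StackProg := whileProg (popSecond .temp') (fun v => v.second.isSome) moveSymbol

/-- Split off the code of the first tree on the value stack, reversing it. -/
def split : StackProg := pushWord .temp' [none] ;; moveTrees

theorem runs_moveSymbol (b : Bool) :
    Runs moveSymbol (workStacks (some b :: A) R T C)
      (workStacks A R (some b :: T) (bif b then none :: none :: C else C)) 7 := fun v => by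
  have hpop : Run (popFirst .value) v (allStacks [] [] (workStacks (some b :: A) R T C)) 1
    { v with first := some (some b) } (allStacks [] [] (workStacks A R T C)) := run_popFirst _ _
  have hput := run_putFirst [] [] (workStacks A R T C) [.temp] { v with first := some (some b) }
    (by decide)
  have hW : (fun k => if k ∈ [WorkStack.temp] then some b :: workStacks A R T C k
      else workStacks A R T C k) = workStacks A R (some b :: T) C := by
    funext k; cases k <;> simp [workStacks]
  simp only [Option.getD_some, hW] at hput
  cases b with
  | false => exact ⟨_, by simp, _, hpop.seq (hput.seq (.ite_false rfl (.load ..)))⟩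
  | true =>
    have hpush : Run (pushWord .temp' [none, none]) { v with first := some (some true) }
      (allStacks [] [] (workStacks A R (some true :: T) C)) _ _
      (allStacks [] [] (workStacks A R (some true :: T) (none :: none :: C))) := run_pushWord _ _ _
    exact ⟨_, by simp, _, hpop.seq (hput.seq (.ite_true rfl hpush))⟩

theorem Runs.moveTrees_cons {b : Bool} {A R T C W n}
    (h : Runs moveTrees (workStacks A R (some b :: T) (bif b then none :: none :: C else C)) W n) :
    Runs moveTrees (workStacks (some b :: A) R T (none :: C)) W (n + 9) := fun v => by
  have hpop : Run (popSecond .temp') v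
      (allStacks [] [] (workStacks (some b :: A) R T (none :: C))) 1
      { v with second := some none } (allStacks [] [] (workStacks (some b :: A) R T C)) :=
    run_popSecond _ _
  obtain ⟨m, hm, v', hmove⟩ := runs_moveSymbol R A T C b { v with second := some none }
  obtain ⟨k, hk, v'', hrest⟩ := h v'
  exact ⟨_, by omega, v'', .while_step hpop rfl hmove hrest⟩

theorem Runs.moveTrees_word (x : BinaryTree Unit) {A R T C W n}
    (h : Runs moveTrees (workStacks A R ((word x).reverse ++ T) C) W n) :
    Runs moveTrees (workStacks (word x ++ A) R T (none :: C)) W (9 * size x + n) := by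
  induction x generalizing A T C n with
  | nil => exact (moveTrees_cons (b := false) h).mono (by simp only [size_nil]; omega)
  | node _ x y hx hy =>
    have hxy := hx (A := word y ++ A) (T := some true :: T) (C := none :: C)
      (hy (T := (word x).reverse ++ some true :: T) (by simpa [word] using h))
    have := moveTrees_cons (b := true) hxy
    refine Runs.mono (n := 9 * size x + (9 * size y + n) + 9) ?_ (by simp only [size_node]; omega)
    simpa [word] using this

theorem runs_split (x : BinaryTree Unit) : Runs split (workStacks (word x ++ A) R T [])
    (workStacks A R ((word x).reverse ++ T) []) (9 * size x + 4) := by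
  have hpush : Runs (pushWord .temp' [none]) (workStacks (word x ++ A) R T [])
    (workStacks (word x ++ A) R T [none]) _ := runs_pushWord _ _
  have hdone : Runs moveTrees (workStacks A R ((word x).reverse ++ T) [])
    (workStacks A R ((word x).reverse ++ T) []) 2 := fun v => by
    have hpop : Run (popSecond .temp') v
      (allStacks [] [] (workStacks A R ((word x).reverse ++ T) [])) 1 { v with second := none }
      (allStacks [] [] (workStacks A R ((word x).reverse ++ T) [])) := run_popSecond _ _
    exact ⟨2, le_rfl, _, .while_done hpop rfl⟩
  exact (hpush.seq (hdone.moveTrees_word x)).mono (by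
    simp only [List.length_cons, List.length_nil]
    omega)

end Splitting

section TreePrograms

/-- `Computes p x y n`: with `x` as the current value, `p` replaces `x` by `y` in at most `n` steps
and leaves alone what has been put aside. -/
def Computes (p : StackProg) (x y : BinaryTree Unit) (n : ℕ) : Prop :=
  ∀ R, Runs p (workStacks (word x) R [] []) (workStacks (word y) R [] []) n

variable {p q c : StackProg} {x x' y z : BinaryTree Unit} {n m k : ℕ}

theorem Computes.mono (h : Computes p x y n) (hnm : n ≤ m) : Computes p x y m :=
  fun R => (h R).mono hnm

theorem Computes.seq (hp : Computes p x y n) (hq : Computes q y z m) :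
    Computes (p ;; q) x z (n + m) := fun R => (hp R).seq (hq R)

theorem computes_nop (x) : Computes (.load id) x x 1 := fun _ => runs_nop _

/-- Pair the results of two programs. -/
def pairing (p q : StackProg) : StackProg := save ;; p ;; swap ;; q ;; join

theorem Computes.pairing (hp : Computes p x y n) (hq : Computes q x z m) :
    Computes (pairing p q) x (y △ z) (n + m + (17 * size x + 16 * size y + 22)) := fun R =>
  ((runs_save R x).seq ((hp _).seq ((runs_swap R x y).seq
    ((hq _).seq (runs_join R y z))))).mono (by omega)

/-- Replace a pair by its second component, leaving the reversed code of the first one on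
`temp`. -/
def openPair : StackProg := popFirst .value ;; split

theorem runs_openPair (R x y) : Runs openPair (workStacks (word (x △ y)) R [] [])
    (workStacks (word y) R (word x).reverse []) (9 * size x + 5) := by
  have h₁ : Runs (popFirst .value) (workStacks (word (x △ y)) R [] [])
    (workStacks (word x ++ word y) R [] []) _ := runs_popFirst _ (by simp [workStacks, word])
  have h₂ : Runs split (workStacks (word x ++ word y) R [] [])
    (workStacks (word y) R (word x).reverse []) (9 * size x + 4) := by
    simpa using runs_split R (word y) [] x
  exact (h₁.seq h₂).mono (by omega)

/-- The first component of a pair. -/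
def takeFirst : StackProg :=
  openPair ;; drain .value [] ;; drain .temp [.value]

theorem computes_takeFirst (x y) :
    Computes takeFirst (x △ y) x (13 * size x + 3 * size y + 9) := fun R => by
  have h₃ : Runs (drain .value []) (workStacks (word y) R (word x).reverse [])
    (workStacks [] R (word x).reverse []) _ := runs_drain (word y) []
  have h₄ : Runs (drain .temp [.value]) (workStacks [] R (word x).reverse [])
    (workStacks (word x) R [] []) _ := runs_drain (word x).reverse []
  exact ((runs_openPair R x y).seq (h₃.seq h₄)).mono (by
    simp only [List.length_cons, List.length_nil, length_word, List.length_reverse]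
    omega)

/-- The second component of a pair. -/
def takeSecond : StackProg := openPair ;; drain .temp []

theorem computes_takeSecond (x y) :
    Computes takeSecond (x △ y) y (12 * size x + 7) := fun R => by
  have h₃ : Runs (drain .temp []) (workStacks (word y) R (word x).reverse [])
    (workStacks (word y) R [] []) _ := runs_drain (word x).reverse []
  exact ((runs_openPair R x y).seq h₃).mono (by
    simp only [List.length_nil, List.length_reverse, length_word]
    omega)

/-- Replace the current value by a fixed one. -/
def putConst (y : BinaryTree Unit) : StackProg := drain .value [] ;; pushWord .value (word y)

theorem computes_putConst (x y) :
    Computes (putConst y) x y (3 * size x + size y + 3) := fun R => by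
  have h₁ : Runs (drain .value []) (workStacks (word x) R [] []) (workStacks [] R [] []) _ :=
    runs_drain (word x) []
  have h₂ : Runs (pushWord .value (word y)) (workStacks [] R [] [])
    (workStacks (word y) R [] []) _ := runs_pushWord _ _
  exact (h₁.seq h₂).mono (by simp only [List.length_nil, length_word]; omega)

/-- The test whether the symbol read last is the first one of the code of a tree other than
`nil`. -/
def isNode (v : Memory) : Bool := v.first == some (some true)

/-- Put the current value aside, compute `c` and read the first symbol of the result. -/
def test (c : StackProg) : StackProg := save ;; c ;; popFirst .value

/-- Discard what is left of the current value and take back the value put aside last. -/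
def reset : StackProg := drain .value [] ;; restore

theorem run_test (hc : Computes c x y n) (R v) : ∃ m ≤ 9 * size x + n + 7, ∃ v',
    (isNode v' = true ↔ y ≠ .nil) ∧ Run (test c) v (allStacks [] [] (workStacks (word x) R [] [])) m
      v' (allStacks [] [] (workStacks (word y).tail (word x ++ none :: R) [] [])) := by
  obtain ⟨m₁, hm₁, v₁, run₁⟩ := runs_save R x v
  obtain ⟨m₂, hm₂, v₂, run₂⟩ := hc (word x ++ none :: R) v₁
  refine ⟨_, ?_, _, ?_, run₁.seq (run₂.seq (run_popFirst _ v₂))⟩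
  · omega
  · cases y <;> simp [isNode, workStacks, word]

theorem runs_reset (R x y) : Runs reset (workStacks (word y).tail (word x ++ none :: R) [] [])
    (workStacks (word x) R [] []) (8 * size x + 3 * size y + 6) := by
  have h₁ : Runs (drain .value []) (workStacks (word y).tail (word x ++ none :: R) [] [])
    (workStacks [] (word x ++ none :: R) [] []) _ := runs_drain (word y).tail []
      (hl := mt List.mem_of_mem_tail (none_notMem_word y))
  exact (h₁.seq (runs_restore R x)).mono (by
    simp only [List.length_nil, List.length_tail, length_word]
    omega)

/-- Branch on whether the value of `c` is different from `nil`. -/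
def branch (c p q : StackProg) : StackProg := test c ;; .ite isNode (reset ;; p) (reset ;; q)

theorem Computes.branch (hc : Computes c x y n) (hp : y ≠ .nil → Computes p x z m)
    (hq : y = .nil → Computes q x z m) :
    Computes (branch c p q) x z (n + m + (17 * size x + 3 * size y + 14)) := fun R v => by
  obtain ⟨m₁, hm₁, v₁, hv₁, run₁⟩ := run_test hc R v
  obtain ⟨m₂, hm₂, v₂, run₂⟩ := runs_reset R x y v₁
  by_cases hy : y = .nil
  · obtain ⟨m₃, hm₃, v₃, run₃⟩ := hq hy R v₂
    exact ⟨_, by omega, v₃, run₁.seq (.ite_false (by simpa [hy] using hv₁) (run₂.seq run₃))⟩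
  · obtain ⟨m₃, hm₃, v₃, run₃⟩ := hp hy R v₂
    exact ⟨_, by omega, v₃, run₁.seq (.ite_true (hv₁.2 hy) (run₂.seq run₃))⟩

/-- Repeat `p` as long as the value of `c` is different from `nil`. -/
def iterateWhile (c p : StackProg) : StackProg :=
  whileProg (test c) isNode (reset ;; p) ;; reset

theorem Computes.iterateWhile_done (hc : Computes c x .nil n) :
    Computes (iterateWhile c p) x x (n + (17 * size x + 17)) := fun R v => by
  obtain ⟨m₁, hm₁, v₁, hv₁, run₁⟩ := run_test hc R v
  obtain ⟨m₂, hm₂, v₂, run₂⟩ := runs_reset R x .nil v₁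
  exact ⟨_, by rw [size_nil] at hm₂; omega, v₂, .seq (.while_done run₁ (by simpa using hv₁)) run₂⟩

theorem Computes.iterateWhile_step (hc : Computes c x y n) (hy : y ≠ .nil)
    (hp : Computes p x x' m) (h : Computes (iterateWhile c p) x' z k) :
    Computes (iterateWhile c p) x z (n + m + k + (17 * size x + 3 * size y + 14)) :=
  fun R v => by
  obtain ⟨m₁, hm₁, v₁, hv₁, run₁⟩ := run_test hc R v
  obtain ⟨m₂, hm₂, v₂, run₂⟩ := runs_reset R x y v₁
  obtain ⟨m₃, hm₃, v₃, run₃⟩ := hp R v₂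
  obtain ⟨m₄, hm₄, v₄, run₄⟩ := h R v₃
  cases run₄ with | seq hwhile hreset =>
  exact ⟨_, by omega, v₄,
    .seq (.while_step run₁ (hv₁.2 hy) (.seq run₂ run₃) hwhile) hreset⟩

theorem computes_iterateWhile {N t B : ℕ} (x y : ℕ → BinaryTree Unit)
    (hc : ∀ i ≤ N, Computes c (x i) (y i) t) (hp : ∀ i < N, Computes p (x i) (x (i + 1)) t)
    (hx : ∀ i ≤ N, size (x i) ≤ B) (hy : ∀ i ≤ N, size (y i) ≤ B)
    (hlt : ∀ i < N, y i ≠ .nil) (hN : y N = .nil) :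
    Computes (iterateWhile c p) (x 0) (x N) ((N + 1) * (2 * t + 20 * B + 17)) := by
  have hx₀ := hx 0 N.zero_le
  have hy₀ := hy 0 N.zero_le
  induction N generalizing x y with
  | zero => exact (Computes.iterateWhile_done (hN ▸ hc 0 le_rfl)).mono (by omega)
  | succ N ih =>
    have hrest := ih (fun i => x (i + 1)) (fun i => y (i + 1)) (fun i hi => hc _ (by omega))
      (fun i hi => hp _ (by omega)) (fun i hi => hx _ (by omega)) (fun i hi => hy _ (by omega))
      (fun i hi => hlt _ (by omega)) hN (hx 1 (by omega)) (hy 1 (by omega))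
    refine ((hc 0 (by omega)).iterateWhile_step (hlt 0 (by omega)) (hp 0 (by omega)) hrest).mono ?_
    rw [add_mul (N + 1)]
    omega

end TreePrograms

section Equality

/-- The tree that stands for a truth value. -/
def boolTree (b : Bool) : BinaryTree Unit := bif b then .nil △ .nil else .nil

theorem size_boolTree_le (b : Bool) : size (boolTree b) ≤ 3 := by cases b <;> simp [boolTree]

/-- Empty `temp` and `temp'`, clearing the flag if their contents are different. -/
def compareWords : StackProg :=
  whileProg (popFirst .temp ;; popSecond .temp') (fun v => v.first.isSome || v.second.isSome)
    (.load fun v => { v with flag := v.flag && v.first == v.second })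

/-- Decide whether the components of a pair are equal. -/
def testEq : StackProg :=
  openPair ;; drain .value [.temp'] ;;
    .load (fun v => { v with flag := true }) ;; compareWords ;;
    .ite Memory.flag (pushWord .value (word (boolTree true)))
      (pushWord .value (word (boolTree false)))

theorem run_compareWords (R T U : List (Option Bool)) (v : Memory) :
    ∃ m ≤ 4 * (T.length + U.length) + 3, ∃ v' : Memory, v'.flag = (v.flag && T == U) ∧
      Run compareWords v (allStacks [] [] (workStacks [] R T U)) m v'
        (allStacks [] [] (workStacks [] R [] [])) := by
  have hpop : Run (popFirst .temp ;; popSecond .temp') v (allStacks [] [] (workStacks [] R T U)) 2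
      { v with first := T.head?, second := U.head? }
      (allStacks [] [] (workStacks [] R T.tail U.tail)) :=
    (run_popFirst (W' := workStacks [] R T.tail U) .temp v).seq (run_popSecond .temp' _)
  by_cases h : T = [] ∧ U = []
  · obtain ⟨rfl, rfl⟩ := h
    exact ⟨3, by simp, _, by simp, .while_done hpop rfl⟩
  · have hlt : T.tail.length + U.tail.length < T.length + U.length := by
      have : T.length ≠ 0 ∨ U.length ≠ 0 := by
        simpa only [Ne, List.length_eq_zero_iff, ← not_and_or] using h
      rw [List.length_tail, List.length_tail]
      omega
    have heq : (T == U) = (T.head? == U.head? && T.tail == U.tail) := by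
      cases T <;> cases U <;> simp
    obtain ⟨m, hm, v', hv', run⟩ := run_compareWords R T.tail U.tail
      { v with first := T.head?, second := U.head?, flag := v.flag && T.head? == U.head? }
    refine ⟨_, ?_, v', ?_, .while_step hpop ?_ (.load ..) run⟩
    · omega
    · rw [hv', heq, Bool.and_assoc]
    · cases T <;> cases U <;> simp at h ⊢
termination_by T.length + U.length

theorem computes_testEq (x y) : Computes testEq (x △ y) (boolTree (word x == word y))
    (13 * size x + 8 * size y + 20) := fun R v => by
  have h₃ : Runs (drain .value [.temp']) (workStacks (word y) R (word x).reverse [])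
    (workStacks [] R (word x).reverse (word y).reverse) _ := runs_drain (word y) []
  obtain ⟨m₂, hm₂, v₂, run₂⟩ := runs_openPair R x y v
  obtain ⟨m₃, hm₃, v₃, run₃⟩ := h₃ v₂
  obtain ⟨m₄, hm₄, v₄, hv₄, run₄⟩ :=
    run_compareWords R (word x).reverse (word y).reverse { v₃ with flag := true }
  have hflag : v₄.flag = (word x == word y) := by
    rw [hv₄, Bool.true_and, Bool.eq_iff_iff, beq_iff_eq, beq_iff_eq, List.reverse_inj]
  have run₅ (b) : Run (pushWord .value (word (boolTree b))) v₄
    (allStacks [] [] (workStacks [] R [] [])) _ v₄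
    (allStacks [] [] (workStacks (word (boolTree b)) R [] [])) := run_pushWord _ _ _
  have hlen := size_boolTree_le (word x == word y)
  simp only [List.length_reverse, length_word, List.length_cons, List.length_nil] at *
  refine ⟨m₂ + (m₃ + (1 + (m₄ + (size (boolTree (word x == word y)) + 1 + 1)))), ?_, v₄,
    run₂.seq (run₃.seq (.seq (.load ..) (run₄.seq ?_)))⟩
  · omega
  · rw [← hflag]
    cases h : v₄.flag with
    | true => exact .ite_true h (run₅ true)
    | false => exact .ite_false h (run₅ false)

end Equality

end Trees

section PolynomialBounds

/-- The function `b` is bounded by a polynomial in `m`. -/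
def PolyBounded {ι : Type} (m b : ι → ℕ) : Prop := ∃ d, ∀ i, b i ≤ (m i + 2) ^ d

namespace PolyBounded

variable {ι κ : Type} {m b b' : ι → ℕ}

theorem mono (h : PolyBounded m b) (hb : ∀ i, b' i ≤ b i) : PolyBounded m b' :=
  let ⟨d, hd⟩ := h
  ⟨d, fun i => (hb i).trans (hd i)⟩

theorem const (n : ℕ) : PolyBounded m fun _ => n :=
  ⟨n, fun _ => Nat.lt_two_pow_self.le.trans (Nat.pow_le_pow_left (by omega) _)⟩

theorem self : PolyBounded m m := ⟨1, fun _ => by simp⟩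

theorem mul (h : PolyBounded m b) (h' : PolyBounded m b') :
    PolyBounded m fun i => b i * b' i := by
  obtain ⟨d, hd⟩ := h
  obtain ⟨d', hd'⟩ := h'
  exact ⟨d + d', fun i => by rw [pow_add]; exact Nat.mul_le_mul (hd i) (hd' i)⟩

theorem add (h : PolyBounded m b) (h' : PolyBounded m b') :
    PolyBounded m fun i => b i + b' i := by
  obtain ⟨d, hd⟩ := h
  obtain ⟨d', hd'⟩ := h'
  refine ⟨d + d' + 1, fun i => ?_⟩
  calc b i + b' i ≤ (m i + 2) ^ (d + d') + (m i + 2) ^ (d + d') := by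
        gcongr
        · exact (hd i).trans (Nat.pow_le_pow_right (by omega) (by omega))
        · exact (hd' i).trans (Nat.pow_le_pow_right (by omega) (by omega))
    _ ≤ (m i + 2) ^ (d + d' + 1) := by rw [← two_mul, pow_succ']; gcongr; omega

theorem pow (h : PolyBounded m b) (n : ℕ) : PolyBounded m fun i => b i ^ n := by
  obtain ⟨d, hd⟩ := h
  exact ⟨d * n, fun i => by rw [pow_mul]; exact Nat.pow_le_pow_left (hd i) _⟩

theorem comp {m b : κ → ℕ} {m' : ι → ℕ} (h : PolyBounded m b) (f : ι → κ)
    (hf : PolyBounded m' fun i => m (f i)) : PolyBounded m' fun i => b (f i) := by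
  obtain ⟨d, hd⟩ := h
  exact ((hf.add (const 2)).pow d).mono fun i => hd (f i)

theorem bound_pow (d : ℕ) : PolyBounded m fun i => (m i + 2) ^ d := ⟨d, fun _ => le_rfl⟩

end PolyBounded

end PolynomialBounds

section PolynomialPrograms

open scoped BinaryTree

/-- One program computes all the trees `y i` from the trees `x i`, where the running times and the
sizes of the results are bounded by a polynomial in `m`. -/
def ComputableWithin {ι : Type} (m : ι → ℕ) (x y : ι → BinaryTree Unit) : Prop :=
  PolyBounded m (fun i => size (y i)) ∧
    ∃ (p : StackProg) (b : ι → ℕ), PolyBounded m b ∧ ∀ i, Computes p (x i) (y i) (b i)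

namespace ComputableWithin

variable {ι κ : Type} {m : ι → ℕ} {x y z : ι → BinaryTree Unit}

theorem refl (hx : PolyBounded m fun i => size (x i)) : ComputableWithin m x x :=
  ⟨hx, _, _, .const 1, fun _ => computes_nop _⟩

theorem congr {y' : ι → BinaryTree Unit} (h : ComputableWithin m x y) (hy : ∀ i, y' i = y i) :
    ComputableWithin m x y' :=
  funext hy ▸ h

theorem trans (hxy : ComputableWithin m x y) (hyz : ComputableWithin m y z) :
    ComputableWithin m x z := by
  obtain ⟨-, p, b, hb, hp⟩ := hxy
  obtain ⟨hz, q, b', hb', hq⟩ := hyz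
  exact ⟨hz, _, _, hb.add hb', fun i => (hp i).seq (hq i)⟩

theorem comp {m' : κ → ℕ} (h : ComputableWithin m x y) (f : κ → ι)
    (hf : PolyBounded m' fun i => m (f i)) :
    ComputableWithin m' (fun i => x (f i)) fun i => y (f i) := by
  obtain ⟨hy, p, b, hb, hp⟩ := h
  exact ⟨hy.comp f hf, p, _, hb.comp f hf, fun i => hp (f i)⟩

theorem const (hx : PolyBounded m fun i => size (x i)) (t : BinaryTree Unit) :
    ComputableWithin m x fun _ => t :=
  ⟨.const _, _, _, (((PolyBounded.const 3).mul hx).add (.const (size t))).add (.const 3),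
    fun _ => computes_putConst _ _⟩

theorem pair (hx : PolyBounded m fun i => size (x i)) (hy : ComputableWithin m x y)
    (hz : ComputableWithin m x z) : ComputableWithin m x fun i => y i △ z i := by
  obtain ⟨hsy, p, b, hb, hp⟩ := hy
  obtain ⟨hsz, q, b', hb', hq⟩ := hz
  exact ⟨((hsy.add hsz).add (.const 1)).mono fun i => (size_node _ _ _).le, _, _,
    (hb.add hb').add ((((PolyBounded.const 17).mul hx).add ((PolyBounded.const 16).mul hsy)).add
      (.const 22)), fun i => (hp i).pairing (hq i)⟩

theorem fst (h : ComputableWithin m x fun i => y i △ z i) : ComputableWithin m x y := by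
  have hs := h.1
  refine h.trans ⟨hs.mono fun i => ?_, takeFirst, _,
    ((PolyBounded.const 13).mul hs).add (.const 9),
    fun i => (computes_takeFirst _ _).mono ?_⟩ <;> simp only [size_node] <;> omega

theorem snd (h : ComputableWithin m x fun i => y i △ z i) : ComputableWithin m x z := by
  have hs := h.1
  refine h.trans ⟨hs.mono fun i => ?_, takeSecond, _,
    ((PolyBounded.const 12).mul hs).add (.const 7),
    fun i => (computes_takeSecond _ _).mono ?_⟩ <;> simp only [size_node] <;> omega

theorem beq (h : ComputableWithin m x fun i => y i △ z i) :
    ComputableWithin m x fun i => boolTree (word (y i) == word (z i)) := by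
  have hs := h.1
  refine h.trans ⟨(PolyBounded.const 3).mono fun i => size_boolTree_le _, testEq, _,
    ((PolyBounded.const 13).mul hs).add (.const 20),
    fun i => (computes_testEq _ _).mono ?_⟩
  simp only [size_node]
  omega

theorem branch {c : ι → BinaryTree Unit} (hx : PolyBounded m fun i => size (x i))
    (hc : ComputableWithin m x c)
    (h : ComputableWithin (fun i : {i // c i = .nil} => m i) (fun i => x i) fun i => y i)
    (h' : ComputableWithin (fun i : {i // c i ≠ .nil} => m i) (fun i => x i) fun i => y i) :
    ComputableWithin m x y := by
  obtain ⟨hsc, r, k, hk, hr⟩ := hc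
  obtain ⟨⟨e, hs⟩, q, b, ⟨d, hb⟩, hq⟩ := h
  obtain ⟨⟨e', hs'⟩, p, b', ⟨d', hb'⟩, hp⟩ := h'
  refine ⟨((PolyBounded.bound_pow e).add (.bound_pow e')).mono fun i => ?_, _, _,
    (hk.add ((PolyBounded.bound_pow d).add (.bound_pow d'))).add
      ((((PolyBounded.const 17).mul hx).add ((PolyBounded.const 3).mul hsc)).add (.const 14)),
    fun i => (hr i).branch (fun hi => (hp ⟨i, hi⟩).mono (le_add_left (hb' ⟨i, hi⟩)))
      fun hi => (hq ⟨i, hi⟩).mono (le_add_right (hb ⟨i, hi⟩))⟩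
  by_cases hi : c i = .nil
  · exact le_add_right (hs ⟨i, hi⟩)
  · exact le_add_left (hs' ⟨i, hi⟩)

theorem iterate {N : ι → ℕ} {s c : ι → ℕ → BinaryTree Unit} (hN : PolyBounded m N)
    (hs : PolyBounded (fun q : Σ i, Fin (N i + 1) => m q.1) fun q => size (s q.1 q.2))
    (hstep : ComputableWithin (fun q : Σ i, Fin (N i) => m q.1) (fun q => s q.1 q.2)
      fun q => s q.1 (q.2 + 1))
    (htest : ComputableWithin (fun q : Σ i, Fin (N i + 1) => m q.1) (fun q => s q.1 q.2)
      fun q => c q.1 q.2)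
    (hc : ∀ i, ∀ n < N i, c i n ≠ .nil) (hcN : ∀ i, c i (N i) = .nil) :
    ComputableWithin m (fun i => s i 0) fun i => s i (N i) := by
  obtain ⟨e, hs⟩ := hs
  obtain ⟨-, p, b, ⟨d, hb⟩, hp⟩ := hstep
  obtain ⟨⟨e', hs'⟩, r, b', ⟨d', hb'⟩, hr⟩ := htest
  refine ⟨⟨e, fun i => hs ⟨i, Fin.last _⟩⟩, _, _, (hN.add (.const 1)).mul
    (((PolyBounded.const 2).mul ((PolyBounded.bound_pow d).add (.bound_pow d'))).add
      ((PolyBounded.const 20).mul ((PolyBounded.bound_pow e).add (.bound_pow e'))) |>.add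
        (.const 17)), fun i => computes_iterateWhile (c := r) (p := p) (s i) (c i)
    (fun n hn => (hr ⟨i, n, Nat.lt_succ_of_le hn⟩).mono (le_add_left (hb' _)))
    (fun n hn => (hp ⟨i, n, hn⟩).mono (le_add_right (hb _)))
    (fun n hn => le_add_right (hs ⟨i, n, Nat.lt_succ_of_le hn⟩))
    (fun n hn => le_add_left (hs' ⟨i, n, Nat.lt_succ_of_le hn⟩)) (hc i) (hcN i)⟩

end ComputableWithin

end PolynomialPrograms

section Encodings

open Function
open scoped BinaryTree

/-- Types whose elements are represented by binary trees. -/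
class TreeEncoding (α : Type) where
  /-- The tree that represents an element. -/
  encode : α → BinaryTree Unit
  encode_injective : Injective encode

open TreeEncoding

/-- Represent the elements of `α` by their images in `β`. -/
abbrev TreeEncoding.ofInjective {α β : Type} [TreeEncoding β] (f : α → β) (hf : Injective f) :
    TreeEncoding α :=
  ⟨fun a => encode (f a), encode_injective.comp hf⟩

variable {α β : Type} [TreeEncoding α] [TreeEncoding β]

instance : TreeEncoding Unit := ⟨fun _ => .nil, fun _ _ _ => rfl⟩

instance : TreeEncoding Bool := ⟨boolTree, fun a b h => by cases a <;> cases b <;> trivial⟩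

instance : TreeEncoding (α × β) where
  encode p := encode p.1 △ encode p.2
  encode_injective p q h := by
    simp only [BinaryTree.node.injEq, true_and] at h
    exact Prod.ext (encode_injective h.1) (encode_injective h.2)

/-- The tree that represents a list. -/
def encodeList : List α → BinaryTree Unit
  | [] => .nil
  | a :: l => encode a △ encodeList l

theorem encodeList_injective : Injective (encodeList (α := α))
  | [], [], _ => rfl
  | [], b :: l', h => by simp [encodeList] at h
  | a :: l, [], h => by simp [encodeList] at h
  | a :: l, b :: l', h => by
    simp only [encodeList, BinaryTree.node.injEq, true_and] at h
    rw [encode_injective h.1, encodeList_injective h.2]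

instance : TreeEncoding (List α) := ⟨encodeList, encodeList_injective⟩

theorem foldr_bit_bits (n : ℕ) : n.bits.foldr Nat.bit 0 = n := by
  induction n using Nat.binaryRec' with
  | zero => simp
  | bit b n h ih => rw [Nat.bits_append_bit _ _ h, List.foldr_cons, ih]

instance : TreeEncoding ℕ := .ofInjective Nat.bits (LeftInverse.injective foldr_bit_bits)

/-- The size of the tree that represents `a`. -/
def encodeSize (a : α) : ℕ := size (encode a)

theorem encodeSize_pos (a : α) : 0 < encodeSize a := size_pos _

@[simp] theorem encodeSize_pair (a : α) (b : β) :
    encodeSize (a, b) = encodeSize a + encodeSize b + 1 := size_node _ _ _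

@[simp] theorem encodeSize_nil : encodeSize ([] : List α) = 1 := rfl

@[simp] theorem encodeSize_cons (a : α) (l : List α) :
    encodeSize (a :: l) = encodeSize a + encodeSize l + 1 := size_node _ _ _

theorem encodeSize_bool_le (b : Bool) : encodeSize b ≤ 3 := size_boolTree_le b

theorem encodeSize_append (l l' : List α) :
    encodeSize (l ++ l') + 1 = encodeSize l + encodeSize l' := by
  induction l with
  | nil => simp [add_comm]
  | cons a l ih => rw [List.cons_append, encodeSize_cons, encodeSize_cons]; omega

theorem encodeSize_reverse (l : List α) : encodeSize l.reverse = encodeSize l := by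
  induction l with
  | nil => rfl
  | cons a l ih =>
    have := encodeSize_append l.reverse [a]
    simp only [encodeSize_cons, encodeSize_nil, List.reverse_cons] at this ⊢
    omega

theorem encodeSize_take_le (l : List α) (n : ℕ) : encodeSize (l.take n) ≤ encodeSize l := by
  have := encodeSize_append (l.take n) (l.drop n)
  rw [List.take_append_drop] at this
  have := encodeSize_pos (l.drop n)
  omega

theorem encodeSize_drop_le (l : List α) (n : ℕ) : encodeSize (l.drop n) ≤ encodeSize l := by
  have := encodeSize_append (l.take n) (l.drop n)
  rw [List.take_append_drop] at this
  have := encodeSize_pos (l.take n)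
  omega

theorem encodeSize_lt_of_mem {a : α} {l : List α} (h : a ∈ l) : encodeSize a < encodeSize l := by
  induction h with
  | head => rw [encodeSize_cons]; omega
  | tail b _ ih => rw [encodeSize_cons]; omega

theorem length_lt_encodeSize (l : List α) : l.length < encodeSize l := by
  induction l with
  | nil => simp
  | cons b l ih => rw [List.length_cons, encodeSize_cons]; omega

theorem encodeSize_list_le {l : List α} {B : ℕ} (h : ∀ a ∈ l, encodeSize a ≤ B) :
    encodeSize l ≤ l.length * (B + 1) + 1 := by
  induction l with
  | nil => simp
  | cons a l ih =>
    have := ih fun b hb => h b (List.mem_cons_of_mem _ hb)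
    have := h a List.mem_cons_self
    rw [encodeSize_cons, List.length_cons, add_mul]
    omega

end Encodings

section PolynomialTime

open Function
open scoped BinaryTree
open TreeEncoding

/-- Case distinction on a list, as an operation that preserves computability in polynomial time. -/
def caseList {β γ : Type} (l : List β) (c : γ) (g : β → List β → γ) : γ :=
  match l with
  | [] => c
  | b :: t => g b t

@[simp] theorem caseList_nil {β γ : Type} (c : γ) (g : β → List β → γ) :
    caseList [] c g = c := rfl

@[simp] theorem caseList_cons {β γ : Type} (b : β) (t : List β) (c : γ) (g : β → List β → γ) :
    caseList (b :: t) c g = g b t := rfl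

/-- The function `f` is computable in polynomial time, with respect to the representations by
trees. -/
@[fun_prop] def PolyTime {α β : Type} [TreeEncoding α] [TreeEncoding β] (f : α → β) : Prop :=
  ComputableWithin encodeSize encode fun a => encode (f a)

namespace PolyTime

variable {α β γ δ : Type} [TreeEncoding α] [TreeEncoding β] [TreeEncoding γ] [TreeEncoding δ]

theorem within {ι : Type} {m : ι → ℕ} {f : α → β} (hf : PolyTime f) (x : ι → α)
    (hx : PolyBounded m fun i => encodeSize (x i)) :
    ComputableWithin m (fun i => encode (x i)) fun i => encode (f (x i)) :=
  ComputableWithin.comp hf x hx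

@[fun_prop] theorem id : PolyTime fun a : α => a := ComputableWithin.refl .self

@[fun_prop] theorem comp {g : β → γ} {f : α → β} (hg : PolyTime g) (hf : PolyTime f) :
    PolyTime fun a => g (f a) :=
  hf.trans (hg.within f hf.1)

@[fun_prop] theorem const (b : β) : PolyTime fun _ : α => b := ComputableWithin.const .self _

@[fun_prop] theorem pair {f : α → β} {g : α → γ} (hf : PolyTime f) (hg : PolyTime g) :
    PolyTime fun a => (f a, g a) :=
  ComputableWithin.pair .self hf hg

@[fun_prop] theorem cons {f : α → β} {g : α → List β} (hf : PolyTime f) (hg : PolyTime g) :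
    PolyTime fun a => f a :: g a :=
  ComputableWithin.pair .self hf hg

@[fun_prop] theorem fst : PolyTime (Prod.fst : α × β → α) :=
  ComputableWithin.fst (ComputableWithin.refl .self)

@[fun_prop] theorem snd : PolyTime (Prod.snd : α × β → β) :=
  ComputableWithin.snd (ComputableWithin.refl .self)

@[fun_prop] theorem beq [BEq β] [LawfulBEq β] {f g : α → β} (hf : PolyTime f) (hg : PolyTime g) :
    PolyTime fun a => f a == g a :=
  (ComputableWithin.beq (ComputableWithin.pair .self hf hg)).congr fun a => congrArg boolTree <| by
    rw [Bool.eq_iff_iff, beq_iff_eq, beq_iff_eq, word_injective.eq_iff, encode_injective.eq_iff]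

@[fun_prop] theorem cond {c : α → Bool} {f g : α → β} (hc : PolyTime c) (hf : PolyTime f)
    (hg : PolyTime g) : PolyTime fun a => bif c a then f a else g a := by
  refine ComputableWithin.branch .self hc
    ((hg.within Subtype.val .self).congr ?_)
    ((hf.within Subtype.val .self).congr ?_) <;>
  · rintro ⟨a, ha⟩
    revert ha
    dsimp only
    cases c a <;> simp [encode, boolTree]

@[fun_prop] protected theorem caseList {l : α → List β} {f : α → γ} {g : α → β → List β → γ}
    (hl : PolyTime l) (hf : PolyTime f)
    (hg : PolyTime fun p : α × β × List β => g p.1 p.2.1 p.2.2) :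
    PolyTime fun a => caseList (l a) (f a) (g a) := by
  refine ComputableWithin.branch .self hl
    ((hf.within Subtype.val .self).congr ?_) ?_
  · rintro ⟨a, ha⟩
    have h : l a = [] := encode_injective ha
    simp only [h, caseList_nil]
  · have hne (i : {a // encode (l a) ≠ .nil}) : l i ≠ [] := fun h => i.2 (by rw [h]; rfl)
    have hcons (i : {a // encode (l a) ≠ .nil}) : l i = (l i).head (hne i) :: (l i).tail :=
      (List.cons_head_tail _).symm
    have hp : ComputableWithin (fun i : {a // encode (l a) ≠ .nil} => encodeSize i.1)
        (fun i => encode i.1) fun i => encode (i.1, (l i).head (hne i), (l i).tail) :=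
      ((pair id hl).within Subtype.val .self).congr fun i =>
        congrArg (fun t => encode i.1 △ encode t) (hcons i).symm
    refine (hp.trans (hg.within _ hp.1)).congr fun i => ?_
    dsimp only
    conv_lhs => rw [hcons i, caseList_cons]

end PolyTime
end PolynomialTime

section PolynomialTimeLists

open Function
open scoped BinaryTree
open TreeEncoding

theorem bits_bit (b : Bool) (n : ℕ) :
    (Nat.bit b n).bits = bif !b && n.bits.isEmpty then [] else b :: n.bits := by
  cases b with
  | true => simp
  | false =>
    rcases eq_or_ne n 0 with rfl | h
    · simp
    · have hne : n.bits ≠ [] := fun hn => h (by rw [← foldr_bit_bits n, hn]; rfl)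
      rw [Nat.bits_append_bit n false (fun h' => absurd h' h)]
      simp [List.isEmpty_eq_false_iff.2 hne]

namespace PolyTime

variable {α β γ δ : Type} [TreeEncoding α] [TreeEncoding β] [TreeEncoding γ] [TreeEncoding δ]

theorem iterate {ι : Type} {m N : ι → ℕ} {x : ι → α} {f : α → α} {test : α → Bool}
    (hf : PolyTime f) (htest : PolyTime test) (hN : PolyBounded m N) {bd : ι → ℕ}
    (hbd : PolyBounded m bd) (hsize : ∀ i, ∀ n ≤ N i, encodeSize (f^[n] (x i)) ≤ bd i)
    (hlt : ∀ i, ∀ n < N i, test (f^[n] (x i)) = true)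
    (hend : ∀ i, test (f^[N i] (x i)) = false) :
    ComputableWithin m (fun i => encode (x i)) fun i => encode (f^[N i] (x i)) := by
  have hbound : PolyBounded (fun q : Σ i, Fin (N i + 1) => m q.1)
      fun q => encodeSize (f^[q.2] (x q.1)) :=
    (hbd.comp Sigma.fst .self).mono fun q => hsize q.1 q.2 (Nat.le_of_lt_succ q.2.2)
  refine .iterate (s := fun i n => encode (f^[n] (x i)))
    (c := fun i n => encode (test (f^[n] (x i)))) hN hbound
    ((hf.within _ (hbound.comp (fun q : Σ i, Fin (N i) => ⟨q.1, q.2.castSucc⟩) .self)).congr ?_)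
    (htest.within _ hbound) ?_ ?_
  · exact fun q => congrArg encode (iterate_succ_apply' f _ _)
  · intro i n hn
    simp only [hlt i n hn]
    exact fun h => nomatch h
  · intro i
    simp only [hend i]
    rfl

@[fun_prop] theorem not {c : α → Bool} (hc : PolyTime c) : PolyTime fun a => !c a := by
  convert cond hc (const false) (const true) with a
  cases c a <;> rfl

@[fun_prop] theorem and {c d : α → Bool} (hc : PolyTime c) (hd : PolyTime d) :
    PolyTime fun a => c a && d a := by
  convert cond hc hd (const false) with a
  cases c a <;> rfl

@[fun_prop] theorem isEmpty {l : α → List β} (hl : PolyTime l) :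
    PolyTime fun a => (l a).isEmpty := by
  have heq (a : α) : (l a).isEmpty = caseList (l a) true fun _ _ => false := by
    cases l a <;> rfl
  simp only [heq]
  fun_prop

@[fun_prop] theorem tail {l : α → List β} (hl : PolyTime l) : PolyTime fun a => (l a).tail := by
  have heq (a : α) : (l a).tail = caseList (l a) [] fun _ t => t := by
    cases l a <;> rfl
  simp only [heq]
  fun_prop

theorem foldl {l : α → List β} {start : α → δ} {g : α → δ → β → δ} (hl : PolyTime l)
    (hstart : PolyTime start) (hg : PolyTime fun p : α × δ × β => g p.1 p.2.1 p.2.2) {bd : α → ℕ}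
    (hbd : PolyBounded encodeSize bd)
    (hsize : ∀ a n, encodeSize (((l a).take n).foldl (g a) (start a)) ≤ bd a) :
    PolyTime fun a => (l a).foldl (g a) (start a) := by
  let step (p : α × δ × List β) : α × δ × List β :=
    caseList p.2.2 p fun b t => (p.1, g p.1 p.2.1 b, t)
  have hstep : PolyTime step :=
    .caseList (by fun_prop) id (pair (by fun_prop) (pair
      (hg.comp (f := fun p : (α × δ × List β) × β × List β => (p.1.1, p.1.2.1, p.2.1))
        (by fun_prop)) (by fun_prop)))
  have hiterate (a : α) (d : δ) (t : List β) (n : ℕ) :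
      step^[n] (a, d, t) = (a, (t.take n).foldl (g a) d, t.drop n) := by
    induction n generalizing d t with
    | zero => rfl
    | succ n ih =>
      rw [iterate_succ_apply]
      cases t with
      | nil => exact (ih d []).trans (by simp)
      | cons b t => exact ih (g a d b) t
  have hloop := iterate (x := fun a => (a, start a, l a)) (N := fun a => (l a).length)
    (test := fun p => !p.2.2.isEmpty) hstep (by fun_prop)
    (hl.1.mono fun a => (length_lt_encodeSize _).le)
    (((PolyBounded.self.add hbd).add hl.1).add (.const 2)) (fun a n _ => ?_) (fun a n hn => ?_)
    fun a => ?_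
  · have hend : PolyTime fun p : α × δ × List β => p.2.1 := by fun_prop
    refine ((show PolyTime fun a => (a, start a, l a) by fun_prop).trans
      (hloop.trans (hend.within _ hloop.1))).congr fun a => ?_
    simp only [hiterate, List.take_length]
  · have := hsize a n
    have := encodeSize_drop_le (l a) n
    simp only [hiterate, encodeSize_pair]
    simp only [encodeSize] at *
    omega
  · simpa [hiterate] using hn
  · simp [hiterate]

@[fun_prop] theorem reverse {l : α → List β} (hl : PolyTime l) :
    PolyTime fun a => (l a).reverse := by
  have heq (t : List β) : t.foldl (fun acc y => y :: acc) [] = t.reverse := by simp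
  simp only [← heq]
  refine foldl hl (by fun_prop) (by fun_prop) hl.1 fun a n => ?_
  rw [heq, encodeSize_reverse]
  exact encodeSize_take_le _ _

@[fun_prop] theorem append {l l' : α → List β} (hl : PolyTime l) (hl' : PolyTime l') :
    PolyTime fun a => l a ++ l' a := by
  have heq (t t' : List β) : t.reverse.foldl (fun acc y => y :: acc) t' = t ++ t' := by simp
  simp only [← heq]
  refine foldl (by fun_prop) hl' (by fun_prop) (hl.1.add hl'.1) fun a n => ?_
  have h₁ := encodeSize_append ((l a).reverse.take n).reverse (l' a)
  have h₂ := encodeSize_take_le (l a).reverse n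
  simp only [encodeSize_reverse] at h₁ h₂
  simp only [List.foldl_flip_cons_eq_append']
  simp only [encodeSize] at *
  omega

@[fun_prop] theorem flatMap {l : α → List β} {g : α → β → List γ} (hl : PolyTime l)
    (hg : PolyTime fun p : α × β => g p.1 p.2) : PolyTime fun a => (l a).flatMap (g a) := by
  obtain ⟨d, hd⟩ := hg.1
  have hle (a : α) (t : List β) (ht : t ⊆ l a) :
      encodeSize (t.flatMap (g a)) ≤ t.length * ((encodeSize (a, l a) + 2) ^ d + 1) + 1 := by
    induction t with
    | nil => simp
    | cons b t ih =>
      obtain ⟨hb, ht⟩ := List.cons_subset.1 ht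
      have happend := encodeSize_append (g a b) (t.flatMap (g a))
      have hgb : encodeSize (g a b) ≤ (encodeSize (a, l a) + 2) ^ d := by
        refine (hd (a, b)).trans (Nat.pow_le_pow_left ?_ d)
        simp only [encodeSize_pair]
        have := encodeSize_lt_of_mem hb
        omega
      have := ih ht
      simp only [List.flatMap_cons, List.length_cons, Nat.succ_mul]
      omega
  simp only [List.flatMap_eq_foldl]
  refine foldl hl (by fun_prop) (append (by fun_prop)
    (hg.comp (f := fun p : α × List γ × β => (p.1, p.2.2)) (by fun_prop)))
    ((hl.1.mul (((PolyTime.id.pair hl).1.add (.const 2) |>.pow d).add (.const 1))).add (.const 1))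
    fun a n => ?_
  rw [← List.flatMap_eq_foldl]
  refine (hle a _ (List.take_subset _ _)).trans ?_
  exact Nat.add_le_add_right (Nat.mul_le_mul_right _ <|
    (List.length_take_le' _ _).trans (length_lt_encodeSize _).le) 1

@[fun_prop] theorem map {l : α → List β} {g : α → β → γ} (hl : PolyTime l)
    (hg : PolyTime fun p : α × β => g p.1 p.2) : PolyTime fun a => (l a).map (g a) := by
  simp only [List.map_eq_flatMap]
  fun_prop

@[fun_prop] theorem filter {l : α → List β} {g : α → β → Bool} (hl : PolyTime l)
    (hg : PolyTime fun p : α × β => g p.1 p.2) : PolyTime fun a => (l a).filter (g a) := by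
  have heq (a : α) : (l a).filter (g a) = (l a).flatMap fun b => bif g a b then [b] else [] := by
    induction l a with
    | nil => rfl
    | cons b t ih => rw [List.flatMap_cons, List.filter_cons, ih]; cases g a b <;> rfl
  simp only [heq]
  fun_prop

@[fun_prop] theorem all {l : α → List β} {g : α → β → Bool} (hl : PolyTime l)
    (hg : PolyTime fun p : α × β => g p.1 p.2) : PolyTime fun a => (l a).all (g a) := by
  have heq (a : α) : (l a).all (g a) = ((l a).filter fun b => !g a b).isEmpty := by
    rw [Bool.eq_iff_iff, List.isEmpty_iff, List.filter_eq_nil_iff]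
    simp
  simp only [heq]
  fun_prop

@[fun_prop] theorem any {l : α → List β} {g : α → β → Bool} (hl : PolyTime l)
    (hg : PolyTime fun p : α × β => g p.1 p.2) : PolyTime fun a => (l a).any (g a) := by
  have heq (a : α) : (l a).any (g a) = !(l a).all fun b => !g a b := by
    simp [List.not_all_eq_any_not]
  simp only [heq]
  fun_prop

@[fun_prop] theorem contains [BEq β] [LawfulBEq β] {l : α → List β} {f : α → β} (hl : PolyTime l)
    (hf : PolyTime f) : PolyTime fun a => (l a).contains (f a) := by
  simp only [List.contains_eq_any_beq]
  fun_prop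

@[fun_prop] theorem bit {b : α → Bool} {f : α → ℕ} (hb : PolyTime b) (hf : PolyTime f) :
    PolyTime fun a => Nat.bit (b a) (f a) := by
  have hbits : PolyTime Nat.bits := ComputableWithin.refl .self
  have h : PolyTime fun a => bif !b a && (f a).bits.isEmpty then [] else b a :: (f a).bits := by
    fun_prop
  exact h.congr fun a => congrArg encode (bits_bit (b a) (f a))

end PolyTime
end PolynomialTimeLists

section Search

open Function TreeEncoding

variable {α : Type} [TreeEncoding α]

/-- A set of variables that may grow to a nest-set. -/
structure Candidate where
  /-- The number of variables that may still be added before the candidate is given up, plus one,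
  in unary. -/
  budget : List Unit
  /-- The variables of the set. -/
  vars : List ℕ
  /-- All clauses that consist of exactly one literal of each variable of the set. -/
  patterns : List Clause

namespace Candidate

/-- The components of a candidate, which is represented by their tree. -/
def toProd (c : Candidate) : List Unit × List ℕ × List Clause := (c.budget, c.vars, c.patterns)

theorem toProd_injective : Injective toProd := fun c c' h => by cases c; cases c'; simp_all [toProd]

instance : TreeEncoding Candidate := .ofInjective toProd toProd_injective

theorem encodeSize_eq (c : Candidate) :
    encodeSize c = encodeSize c.budget + (encodeSize c.vars + encodeSize c.patterns + 1) + 1 := by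
  simp only [← encodeSize_pair]
  rfl

theorem polyTime_toProd : PolyTime toProd := ComputableWithin.refl .self

@[fun_prop] theorem polyTime_budget : PolyTime budget := PolyTime.fst.comp polyTime_toProd

@[fun_prop] theorem polyTime_vars : PolyTime vars :=
  PolyTime.fst.comp (PolyTime.snd.comp polyTime_toProd)

@[fun_prop] theorem polyTime_patterns : PolyTime patterns :=
  PolyTime.snd.comp (PolyTime.snd.comp polyTime_toProd)

@[fun_prop] theorem polyTime_mk {b : α → List Unit} {s : α → List ℕ} {A : α → List Clause}
    (hb : PolyTime b) (hs : PolyTime s) (hA : PolyTime A) :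
    PolyTime fun a => mk (b a) (s a) (A a) :=
  hb.pair (hs.pair hA)

/-- Add a variable to a candidate. -/
def extend (c : Candidate) (x : ℕ) : Candidate where
  budget := c.budget.tail
  vars := x :: c.vars
  patterns := c.patterns.flatMap fun a => [(x, true) :: a, (x, false) :: a]

@[fun_prop] theorem polyTime_extend {c : α → Candidate} {x : α → ℕ} (hc : PolyTime c)
    (hx : PolyTime x) : PolyTime fun a => (c a).extend (x a) := by
  unfold extend
  fun_prop

end Candidate

/-- A state of the search for nest-sets. -/
structure SearchState where
  /-- The formula that is left. -/
  formula : CNF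
  /-- The size of the nest-sets that are searched for, in unary. -/
  width : List Unit
  /-- The candidates that have not been examined. -/
  queue : List Candidate

namespace SearchState

/-- The components of a state, which is represented by their tree. -/
def toProd (q : SearchState) : CNF × List Unit × List Candidate := (q.formula, q.width, q.queue)

theorem toProd_injective : Injective toProd := fun q q' h => by cases q; cases q'; simp_all [toProd]

instance : TreeEncoding SearchState := .ofInjective toProd toProd_injective

theorem encodeSize_eq (q : SearchState) :
    encodeSize q = encodeSize q.formula + (encodeSize q.width + encodeSize q.queue + 1) + 1 := by
  simp only [← encodeSize_pair]
  rfl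

theorem polyTime_toProd : PolyTime toProd := ComputableWithin.refl .self

@[fun_prop] theorem polyTime_formula : PolyTime formula := PolyTime.fst.comp polyTime_toProd

@[fun_prop] theorem polyTime_width : PolyTime width :=
  PolyTime.fst.comp (PolyTime.snd.comp polyTime_toProd)

@[fun_prop] theorem polyTime_queue : PolyTime queue :=
  PolyTime.snd.comp (PolyTime.snd.comp polyTime_toProd)

@[fun_prop] theorem polyTime_mk {F : α → CNF} {k : α → List Unit} {w : α → List Candidate}
    (hF : PolyTime F) (hk : PolyTime k) (hw : PolyTime w) :
    PolyTime fun a => mk (F a) (k a) (w a) :=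
  hF.pair (hk.pair hw)

end SearchState

/-- The clause `C` has a variable in `s`. -/
def touches (C : Clause) (s : List ℕ) : Bool := C.any fun l => s.contains l.1

@[fun_prop] theorem polyTime_touches {C : α → Clause} {s : α → List ℕ} (hC : PolyTime C)
    (hs : PolyTime s) : PolyTime fun a => touches (C a) (s a) := by
  unfold touches
  fun_prop

/-- The variable `x` is neither in `C` nor in `s`. -/
def avoids (x : ℕ) (C : Clause) (s : List ℕ) : Bool :=
  !(C.any fun l => l.1 == x) && !s.contains x

@[fun_prop] theorem polyTime_avoids {x : α → ℕ} {C : α → Clause} {s : α → List ℕ} (hx : PolyTime x)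
    (hC : PolyTime C) (hs : PolyTime s) : PolyTime fun a => avoids (x a) (C a) (s a) := by
  unfold avoids
  fun_prop

/-- The pairs of variables that show that `s` is not a nest-set. -/
def conflicts (F : CNF) (s : List ℕ) : List (ℕ × ℕ) :=
  F.flatMap fun C => F.flatMap fun C' => C.flatMap fun l => C'.flatMap fun l' =>
    bif (touches C s && avoids l.1 C' s) && (touches C' s && avoids l'.1 C s) then [(l.1, l'.1)]
    else []

@[fun_prop] theorem polyTime_conflicts {F : α → CNF} {s : α → List ℕ} (hF : PolyTime F)
    (hs : PolyTime s) : PolyTime fun a => conflicts (F a) (s a) := by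
  unfold conflicts
  fun_prop

/-- The clause `D` contains a clause of `F`. -/
def subsumes (F : CNF) (D : Clause) : Bool := F.any fun C => C.all fun l => D.contains l

@[fun_prop] theorem polyTime_subsumes {F : α → CNF} {D : α → Clause} (hF : PolyTime F)
    (hD : PolyTime D) : PolyTime fun a => subsumes (F a) (D a) := by
  unfold subsumes
  fun_prop

/-- The elimination of the variables in `s` from `F`. Here `A` consists of all clauses made up of
exactly one literal of each variable in `s`. -/
def eliminate (F : CNF) (s : List ℕ) (A : List Clause) : CNF :=
  (F.map fun C => C.filter fun l => !s.contains l.1).filter fun D =>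
    A.all fun a => subsumes F (a ++ D)

@[fun_prop] theorem polyTime_eliminate {F : α → CNF} {s : α → List ℕ} {A : α → List Clause}
    (hF : PolyTime F) (hs : PolyTime s) (hA : PolyTime A) :
    PolyTime fun a => eliminate (F a) (s a) (A a) := by
  unfold eliminate
  fun_prop

/-- The variables of a formula, with repetitions. -/
def occurrences (F : CNF) : List ℕ := F.flatMap fun C => C.map Prod.fst

/-- All candidates with one element. -/
def singletons (F : CNF) (k : List Unit) : List Candidate :=
  (occurrences F).map fun x => Candidate.extend ⟨() :: k, [], [[]]⟩ x

@[fun_prop] theorem polyTime_singletons {F : α → CNF} {k : α → List Unit} (hF : PolyTime F)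
    (hk : PolyTime k) : PolyTime fun a => singletons (F a) (k a) := by
  unfold singletons occurrences
  fun_prop

/-- Eliminate the set of the candidate `c` if it is a nest-set; otherwise branch on a conflict, of
which every nest-set that contains the set of `c` contains one of the two variables. -/
def examine (q : SearchState) (c : Candidate) (queue : List Candidate) : SearchState :=
  caseList (conflicts q.formula c.vars) ⟨eliminate q.formula c.vars c.patterns, [], []⟩ fun p _ =>
    ⟨q.formula, q.width, c.extend p.1 :: c.extend p.2 :: queue⟩

@[fun_prop] theorem polyTime_examine {q : α → SearchState} {c : α → Candidate}
    {w : α → List Candidate} (hq : PolyTime q) (hc : PolyTime c) (hw : PolyTime w) :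
    PolyTime fun a => examine (q a) (c a) (w a) := by
  unfold examine
  fun_prop

/-- One step of the algorithm: take the next candidate, or start the search for larger nest-sets
when no candidates are left. -/
def step (q : SearchState) : SearchState :=
  caseList q.queue ⟨q.formula, () :: q.width, singletons q.formula (() :: q.width)⟩ fun c queue =>
    bif c.budget.isEmpty then ⟨q.formula, q.width, queue⟩ else examine q c queue

theorem polyTime_step : PolyTime step := by
  unfold step
  fun_prop

/-- Has the formula a variable? -/
def hasVar (F : CNF) : Bool := F.any fun C => !C.isEmpty

@[fun_prop] theorem polyTime_hasVar : PolyTime hasVar := by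
  unfold hasVar
  fun_prop

end Search

section Parsing

open Function TreeEncoding

/-- The letters of the input alphabet as lists, by which they are represented. -/
def symbolValue : Symbol → List (Bool × Bool)
  | .clauseEnd => []
  | .positive => [(false, true)]
  | .negative => [(false, false)]
  | .bit b => [(true, b)]

theorem symbolValue_injective : Injective symbolValue
  | .clauseEnd, .clauseEnd, _ | .positive, .positive, _ | .negative, .negative, _ => rfl
  | .bit _, .bit _, rfl => rfl

instance : TreeEncoding Symbol := .ofInjective symbolValue symbolValue_injective

theorem encodeSize_symbol_le (a : Symbol) : encodeSize a ≤ 9 := by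
  have hle : ∀ p : Bool × Bool, encodeSize [p] ≤ 9 := fun ⟨b, b'⟩ => by
    have := encodeSize_bool_le b
    have := encodeSize_bool_le b'
    simp only [encodeSize_cons, encodeSize_pair, encodeSize_nil]
    omega
  cases a with
  | clauseEnd => exact (by decide : 1 ≤ 9)
  | _ => exact hle _

theorem polyTime_symbolValue : PolyTime symbolValue := ComputableWithin.refl .self

/-- Add a literal to the first clause of a formula. -/
def addLiteral (l : Literal) (F : CNF) : CNF := caseList F [] fun C F' => (l :: C) :: F'

/-- Add a symbol in front of a partially read formula, where the second component is the number
whose digits have been read since the last sign. -/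
def readSymbol (acc : CNF × ℕ) : Symbol → CNF × ℕ
  | .clauseEnd => ([] :: acc.1, 0)
  | .positive => (addLiteral (acc.2, true) acc.1, 0)
  | .negative => (addLiteral (acc.2, false) acc.1, 0)
  | .bit b => (acc.1, Nat.bit b acc.2)

theorem polyTime_readSymbol : PolyTime fun p : (CNF × ℕ) × Symbol => readSymbol p.1 p.2 := by
  have heq (p : (CNF × ℕ) × Symbol) : readSymbol p.1 p.2 =
      caseList (symbolValue p.2) ([] :: p.1.1, 0) fun v _ =>
        bif v.1 then (p.1.1, Nat.bit v.2 p.1.2) else (addLiteral (p.1.2, v.2) p.1.1, 0) := by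
    obtain ⟨acc, _ | _ | b | _⟩ := p <;> rfl
  have := polyTime_symbolValue
  unfold addLiteral at heq
  simp only [heq]
  fun_prop

theorem encodeSize_bit_le (b : Bool) (n : ℕ) : encodeSize (Nat.bit b n) ≤ encodeSize n + 4 := by
  change encodeSize (Nat.bit b n).bits ≤ encodeSize n.bits + 4
  have := encodeSize_pos n.bits
  have := encodeSize_bool_le b
  rw [bits_bit]
  rcases Bool.eq_false_or_eq_true (!b && n.bits.isEmpty) with h | h
  · simp [h]
  · simp only [h, cond_false, encodeSize_cons]
    omega

theorem encodeSize_readSymbol_le (acc : CNF × ℕ) (a : Symbol) :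
    encodeSize (readSymbol acc a) ≤ encodeSize acc + 6 := by
  have hpos := encodeSize_pos acc.2
  have hacc : encodeSize acc = encodeSize acc.1 + encodeSize acc.2 + 1 := encodeSize_pair ..
  have hzero : encodeSize 0 = 1 := by decide
  have hadd (b : Bool) : encodeSize (addLiteral (acc.2, b) acc.1) ≤
      encodeSize acc.1 + encodeSize acc.2 + 5 := by
    have := encodeSize_bool_le b
    unfold addLiteral
    cases acc.1 with
    | nil => simp only [caseList_nil, encodeSize_nil]; omega
    | cons C F => simp only [caseList_cons, encodeSize_cons, encodeSize_pair]; omega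
  cases a with
  | clauseEnd =>
    simp only [readSymbol, encodeSize_pair, encodeSize_cons, encodeSize_nil, hzero]
    omega
  | positive => have := hadd true; simp only [readSymbol, encodeSize_pair, hzero]; omega
  | negative => have := hadd false; simp only [readSymbol, encodeSize_pair, hzero]; omega
  | bit b => have := encodeSize_bit_le b acc.2; simp only [readSymbol, encodeSize_pair]; omega

/-- Read a formula from right to left. -/
def parse (w : List Symbol) : CNF := (w.foldl readSymbol ([], 0)).1

theorem polyTime_parse : PolyTime parse := by
  have hle (w : List Symbol) :
      encodeSize (w.foldl readSymbol ([], 0)) ≤ 6 * w.length + 3 := by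
    induction w using List.reverseRecOn with
    | nil => decide
    | append_singleton w a ih =>
      have := encodeSize_readSymbol_le (w.foldl readSymbol ([], 0)) a
      simp only [List.foldl_append, List.foldl_cons, List.foldl_nil, List.length_append,
        List.length_singleton]
      omega
  refine PolyTime.fst.comp (.foldl .id (.const _)
    (polyTime_readSymbol.comp (f := fun p : List Symbol × (CNF × ℕ) × Symbol => p.2) .snd)
    (((PolyBounded.const 6).mul .self).add (.const 3)) fun w n => (hle _).trans ?_)
  have := length_lt_encodeSize w
  have := List.length_take_le' n w
  omega

theorem parse_encodeCNF (F : CNF) : parse (encodeCNF F).reverse = F := by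
  let f : Symbol → CNF × ℕ → CNF × ℕ := fun a acc => readSymbol acc a
  have hliteral (l : Literal) (C : Clause) (G : CNF) :
      (encodeLiteral l).foldr f (C :: G, 0) = ((l :: C) :: G, 0) := by
    have hbits : (l.1.bits.map Symbol.bit).foldr f (C :: G, 0) = (C :: G, l.1) := by
      rw [List.foldr_map]
      conv_rhs => rw [← foldr_bit_bits l.1]
      induction l.1.bits with
      | nil => rfl
      | cons b t ih => rw [List.foldr_cons, ih]; rfl
    obtain ⟨x, _ | _⟩ := l <;> simp only [encodeLiteral, List.foldr_cons, hbits] <;> rfl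
  have hliterals (C : Clause) (G : CNF) :
      (C.flatMap encodeLiteral).foldr f ([] :: G, 0) = (C :: G, 0) := by
    induction C with
    | nil => rfl
    | cons l C ih => rw [List.flatMap_cons, List.foldr_append, ih, hliteral]
  have hformula : (encodeCNF F).foldr f ([], 0) = (F, 0) := by
    unfold encodeCNF
    induction F with
    | nil => rfl
    | cons C F ih =>
      rw [List.flatMap_cons, List.foldr_append, ih]
      exact List.foldr_append.trans (hliterals C F)
  rw [parse, List.foldl_reverse]
  exact congrArg Prod.fst hformula

end Parsing

section Hypergraphs

open scoped Hypergraph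

variable {α : Type*} {H H' H'' : Hypergraph α} {s : Set α} {k : ℕ}

/-- The non-empty edges of `H'` are among the traces of the edges of `H` on the vertices of `H'`,
so `H'` arises from `H` by deleting vertices and edges and adding at most the empty edge. -/
def IsPartialTrace (H' H : Hypergraph α) : Prop :=
  V(H') ⊆ V(H) ∧ ∀ e' ∈ E(H'), e'.Nonempty → ∃ e ∈ E(H), e' = e ∩ V(H')

theorem isPartialTrace_deleteVertices (H : Hypergraph α) (s : Set α) :
    IsPartialTrace (deleteVertices H s) H :=
  ⟨Set.sdiff_subset, fun _ he _ => he.2⟩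

theorem IsPartialTrace.trans (h' : IsPartialTrace H'' H') (h : IsPartialTrace H' H) :
    IsPartialTrace H'' H := by
  refine ⟨h'.1.trans h.1, fun e'' he'' hne => ?_⟩
  obtain ⟨e', he', rfl⟩ := h'.2 e'' he'' hne
  obtain ⟨e, he, rfl⟩ := h.2 e' he' hne.left
  exact ⟨e, he, by rw [Set.inter_assoc, Set.inter_eq_right.2 h'.1]⟩

theorem IsPartialTrace.deleteVertices_right (h : IsPartialTrace H' H) (hs : Disjoint V(H') s) :
    IsPartialTrace H' (deleteVertices H s) := by
  have hV : V(H') ⊆ V(H) \ s := Set.subset_sdiff.2 ⟨h.1, hs⟩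
  refine ⟨hV, fun e' he' hne => ?_⟩
  obtain ⟨e, he, rfl⟩ := h.2 e' he' hne
  exact ⟨e ∩ (V(H) \ s), ⟨hne.mono (Set.inter_subset_inter_right e hV), e, he, rfl⟩,
    by rw [Set.inter_assoc, Set.inter_eq_right.2 hV]⟩

theorem IsNestSet.inter_vertexSet (hs : IsNestSet H s) (h : IsPartialTrace H' H)
    (hne : (s ∩ V(H')).Nonempty) : IsNestSet H' (s ∩ V(H')) := by
  have htrace : ∀ e' ∈ incidentEdges H' (s ∩ V(H')), ∃ e ∈ incidentEdges H s,
      e' \ (s ∩ V(H')) = (e \ s) ∩ V(H') := by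
    rintro e' ⟨he', v, hv, hve⟩
    obtain ⟨e, he, rfl⟩ := h.2 e' he' ⟨v, hve⟩
    exact ⟨e, ⟨he, v, hv.1, hve.1⟩, by grind⟩
  refine ⟨hne, Set.inter_subset_right, ?_⟩
  rintro _ ⟨e', he', rfl⟩ _ ⟨f', hf', rfl⟩ -
  obtain ⟨e, he, hee'⟩ := htrace e' he'
  obtain ⟨f, hf, hff'⟩ := htrace f' hf'
  simp only [hee', hff']
  exact (hs.2.2.total ⟨e, he, rfl⟩ ⟨f, hf, rfl⟩).imp (Set.inter_subset_inter_left _)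
    (Set.inter_subset_inter_left _)

/-- `H` has a nest-set elimination ordering of width `k`. -/
def HasKNEO (H : Hypergraph α) (k : ℕ) : Prop := ∃ O, IsKNEO H k O

theorem IsPartialTrace.hasKNEO (h : IsPartialTrace H' H) (hH : HasKNEO H k) : HasKNEO H' k := by
  obtain ⟨O, hO⟩ := hH
  induction O generalizing H H' with
  | nil => exact ⟨[], Set.subset_eq_empty h.1 hO.1, by simp⟩
  | cons s O ih =>
    obtain ⟨⟨hs, hO⟩, hk⟩ := hO
    rw [List.forall_mem_cons] at hk
    have ih {H'' : Hypergraph α} (hH'' : IsPartialTrace H'' H) (hd : Disjoint V(H'') s) :=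
      ih (hH''.deleteVertices_right hd) ⟨hO, hk.2⟩
    rcases (s ∩ V(H')).eq_empty_or_nonempty with hempty | hne
    · exact ih h (Set.disjoint_iff_inter_eq_empty.2 hempty).symm
    · obtain ⟨O', hO', hk'⟩ := ih ((isPartialTrace_deleteVertices H' (s ∩ V(H'))).trans h)
        (Set.disjoint_left.2 fun x hx hxs => hx.2 ⟨hxs, hx.1⟩)
      exact ⟨(s ∩ V(H')) :: O', ⟨hs.inter_vertexSet h hne, hO'⟩, List.forall_mem_cons.2
        ⟨(Set.encard_le_encard Set.inter_subset_left).trans hk.1, hk'⟩⟩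

theorem hasKNEO_nestSetWidth (hV : V(H).Finite) : HasKNEO H (nestSetWidth H) :=
  Nat.sInf_mem (exists_isKNEO H hV)

theorem HasKNEO.exists_isNestSet (h : HasKNEO H k) (hV : V(H).Nonempty) :
    ∃ s, IsNestSet H s ∧ s.encard ≤ k := by
  obtain ⟨_ | ⟨s, O⟩, hO, hk⟩ := h
  · exact absurd hO hV.ne_empty
  · exact ⟨s, hO.1, hk s List.mem_cons_self⟩

theorem HasKNEO.pos (h : HasKNEO H k) (hV : V(H).Nonempty) : 0 < k := by
  obtain ⟨s, hs, hk⟩ := h.exists_isNestSet hV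
  exact_mod_cast (Set.encard_pos.2 hs.1).trans_le hk

end Hypergraphs

section Elimination

open scoped Hypergraph

variable {F : CNF} {C : Clause} {s : List ℕ} {A : List Clause}

theorem mem_vertexSet_iff {x : ℕ} : x ∈ V(formulaHypergraph F) ↔ x ∈ occurrences F := by
  simp only [occurrences, List.mem_flatMap, List.mem_map]
  rfl

theorem finite_vertexSet (F : CNF) : V(formulaHypergraph F).Finite :=
  (List.finite_toSet (occurrences F)).subset fun _ => mem_vertexSet_iff.1

theorem hasVar_iff : hasVar F = true ↔ V(formulaHypergraph F).Nonempty := by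
  simp only [hasVar, List.any_eq_true, Bool.not_eq_true', List.isEmpty_eq_false_iff_exists_mem]
  exact ⟨fun ⟨C, hC, l, hl⟩ => ⟨l.1, C, hC, l, hl, rfl⟩, fun ⟨_, C, hC, l, hl, _⟩ => ⟨C, hC, l, hl⟩⟩

theorem touches_iff : touches C s = true ↔ ∃ x ∈ s, x ∈ clauseVars C := by
  simp only [touches, List.any_eq_true, List.contains_iff_mem, clauseVars]
  grind

theorem avoids_iff {x : ℕ} : avoids x C s = true ↔ x ∉ clauseVars C ∧ x ∉ s := by
  simp only [avoids, clauseVars, Bool.and_eq_true, Bool.not_eq_true', List.any_eq_false, beq_iff_eq,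
    List.contains_eq_mem, decide_eq_false_iff_not, Set.mem_ofPred_eq, not_exists, not_and]

theorem clauseVars_mem_incidentEdges (hC : C ∈ F) (hs : touches C s = true) :
    clauseVars C ∈ incidentEdges (formulaHypergraph F) {x | x ∈ s} :=
  ⟨⟨C, hC, rfl⟩, touches_iff.1 hs⟩

theorem mem_conflicts {p : ℕ × ℕ} :
    p ∈ conflicts F s ↔ ∃ e ∈ incidentEdges (formulaHypergraph F) {x | x ∈ s},
      ∃ e' ∈ incidentEdges (formulaHypergraph F) {x | x ∈ s},
        p.1 ∈ (e \ {x | x ∈ s}) \ e' ∧ p.2 ∈ (e' \ {x | x ∈ s}) \ e := by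
  have hmem : p ∈ conflicts F s ↔ ∃ C ∈ F, ∃ C' ∈ F, ∃ l ∈ C, ∃ l' ∈ C',
      ((touches C s = true ∧ avoids l.1 C' s = true) ∧
        (touches C' s = true ∧ avoids l'.1 C s = true)) ∧ p = (l.1, l'.1) := by
    simp only [conflicts, List.mem_flatMap, Bool.cond_eq_ite, Bool.and_eq_true,
      List.mem_ite_nil_right, List.mem_singleton]
  rw [hmem]
  constructor
  · rintro ⟨C, hC, C', hC', l, hl, l', hl', ⟨⟨ht, ha⟩, ht', ha'⟩, rfl⟩
    rw [avoids_iff] at ha ha'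
    exact ⟨_, clauseVars_mem_incidentEdges hC ht, _, clauseVars_mem_incidentEdges hC' ht',
      ⟨⟨⟨l, hl, rfl⟩, ha.2⟩, ha.1⟩, ⟨⟨l', hl', rfl⟩, ha'.2⟩, ha'.1⟩
  · rintro ⟨_, ⟨⟨C, hC, rfl⟩, ht⟩, _, ⟨⟨C', hC', rfl⟩, ht'⟩, ⟨⟨⟨l, hl, hlp⟩, hs⟩, ha⟩,
      ⟨⟨l', hl', hlp'⟩, hs'⟩, ha'⟩
    rw [← hlp] at hs ha
    rw [← hlp'] at hs' ha'
    exact ⟨C, hC, C', hC', l, hl, l', hl', ⟨⟨touches_iff.2 ht, avoids_iff.2 ⟨ha, hs⟩⟩,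
      touches_iff.2 ht', avoids_iff.2 ⟨ha', hs'⟩⟩, Prod.ext hlp.symm hlp'.symm⟩

theorem isChain_of_conflicts_eq_nil (h : conflicts F s = []) :
    IsChain (· ⊆ ·) ((fun e : Set ℕ => e \ {x | x ∈ s}) ''
      incidentEdges (formulaHypergraph F) {x | x ∈ s}) := by
  rintro _ ⟨e, he, rfl⟩ _ ⟨e', he', rfl⟩ -
  by_contra! hincomparable
  obtain ⟨⟨x, hx, hx'⟩, y, hy, hy'⟩ := hincomparable.imp Set.not_subset.1 Set.not_subset.1
  have : (x, y) ∈ conflicts F s := mem_conflicts.2 ⟨e, he, e', he',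
    ⟨hx, fun h => hx' ⟨h, hx.2⟩⟩, hy, fun h => hy' ⟨h, hy.2⟩⟩
  simp [h] at this

theorem IsNestSet.mem_or_mem_of_mem_conflicts {S : Set ℕ} {p : ℕ × ℕ}
    (hS : IsNestSet (formulaHypergraph F) S) (hs : ∀ x ∈ s, x ∈ S) (hp : p ∈ conflicts F s) :
    p.1 ∈ S ∨ p.2 ∈ S := by
  obtain ⟨e, ⟨he, v, hv, hve⟩, e', ⟨he', v', hv', hve'⟩, ⟨⟨h₁, -⟩, h₁'⟩, ⟨h₂, -⟩, h₂'⟩ :=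
    mem_conflicts.1 hp
  by_contra! hcon
  rcases hS.2.2.total ⟨e, ⟨he, v, hs v hv, hve⟩, rfl⟩ ⟨e', ⟨he', v', hs v' hv', hve'⟩, rfl⟩
    with h | h
  · exact h₁' (h ⟨h₁, hcon.1⟩).1
  · exact h₂' (h ⟨h₂, hcon.2⟩).1

theorem mem_vertexSet_of_mem_conflicts {p : ℕ × ℕ} (hp : p ∈ conflicts F s) :
    (p.1 ∈ V(formulaHypergraph F) ∧ p.1 ∉ s) ∧ p.2 ∈ V(formulaHypergraph F) ∧ p.2 ∉ s := by
  obtain ⟨e, he, e', he', ⟨h₁, -⟩, h₂, -⟩ := mem_conflicts.1 hp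
  have hV {e : Set ℕ} (he : e ∈ E(formulaHypergraph F)) : e ⊆ V(formulaHypergraph F) :=
    (formulaHypergraph F).subset_vertexSet_of_mem_edgeSet' he
  exact ⟨⟨hV he.1 h₁.1, h₁.2⟩, hV he'.1 h₂.1, h₂.2⟩

theorem mem_eliminate {D : Clause} :
    D ∈ eliminate F s A ↔ (∃ C ∈ F, C.filter (fun l => !s.contains l.1) = D) ∧
      ∀ a ∈ A, ∃ C ∈ F, ∀ l ∈ C, l ∈ a ∨ l ∈ D := by
  simp [eliminate, subsumes, List.mem_filter]

theorem isPartialTrace_eliminate (F : CNF) (s : List ℕ) (A : List Clause) :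
    IsPartialTrace (formulaHypergraph (eliminate F s A)) (formulaHypergraph F) := by
  have hmem : ∀ D ∈ eliminate F s A, ∃ C ∈ F, ∀ x, x ∈ clauseVars D ↔ x ∈ clauseVars C ∧ x ∉ s := by
    intro D hD
    obtain ⟨⟨C, hC, rfl⟩, -⟩ := mem_eliminate.1 hD
    refine ⟨C, hC, fun x => ?_⟩
    simp only [clauseVars, Set.mem_ofPred_eq, List.mem_filter, Bool.not_eq_true',
      List.contains_eq_mem, decide_eq_false_iff_not]
    grind
  refine ⟨?_, ?_⟩
  · rintro x ⟨D, hD, hx⟩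
    obtain ⟨C, hC, hDC⟩ := hmem D hD
    exact ⟨C, hC, ((hDC x).1 hx).1⟩
  · rintro _ ⟨D, hD, rfl⟩ -
    obtain ⟨C, hC, hDC⟩ := hmem D hD
    refine ⟨clauseVars C, ⟨C, hC, rfl⟩, Set.ext fun x => ?_⟩
    refine ⟨fun hx => ⟨((hDC x).1 hx).1, D, hD, hx⟩, fun ⟨hx, D', hD', hx'⟩ => ?_⟩
    obtain ⟨C', -, hDC'⟩ := hmem D' hD'
    exact (hDC x).2 ⟨hx, ((hDC' x).1 hx').2⟩

theorem notMem_vertexSet_eliminate {x : ℕ} (hx : x ∈ s) :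
    x ∉ V(formulaHypergraph (eliminate F s A)) := by
  rintro ⟨D, hD, l, hl, rfl⟩
  obtain ⟨⟨C, -, rfl⟩, -⟩ := mem_eliminate.1 hD
  simp [hx] at hl

theorem ncard_vertexSet_eliminate_lt {x : ℕ} (hx : x ∈ s) (hxF : x ∈ V(formulaHypergraph F)) :
    V(formulaHypergraph (eliminate F s A)).ncard < V(formulaHypergraph F).ncard :=
  Set.ncard_lt_ncard ⟨(isPartialTrace_eliminate F s A).1,
    fun h => notMem_vertexSet_eliminate hx (h hxF)⟩ (finite_vertexSet F)

/-- All clauses that consist of exactly one literal of each variable in `s`. -/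
def signPatterns : List ℕ → List Clause
  | [] => [[]]
  | x :: s => (signPatterns s).flatMap fun a => [(x, true) :: a, (x, false) :: a]

theorem length_signPatterns (s : List ℕ) : (signPatterns s).length = 2 ^ s.length := by
  induction s with
  | nil => rfl
  | cons x s ih =>
    simp only [signPatterns, List.length_flatMap, List.length_cons, List.length_nil,
      List.map_const', List.sum_replicate, smul_eq_mul, ih, pow_succ]

theorem mem_signPatterns (hs : s.Nodup) {a : Clause} :
    a ∈ signPatterns s ↔ ∃ σ : ℕ → Bool, a = s.map fun x => (x, σ x) := by
  induction s generalizing a with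
  | nil => simp [signPatterns]
  | cons x s ih =>
    rw [List.nodup_cons] at hs
    have hcons : a ∈ signPatterns (x :: s) ↔ ∃ a' ∈ signPatterns s, ∃ b, a = (x, b) :: a' := by
      simp [signPatterns, or_comm]
    rw [hcons]
    constructor
    · rintro ⟨a', ha', b, rfl⟩
      obtain ⟨σ, rfl⟩ := (ih hs.2).1 ha'
      refine ⟨Function.update σ x b, ?_⟩
      rw [List.map_cons, Function.update_self]
      refine congrArg _ (List.map_congr_left fun y hy => ?_)
      rw [Function.update_of_ne (ne_of_mem_of_not_mem hy hs.1)]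
    · rintro ⟨σ, rfl⟩
      exact ⟨_, (ih hs.2).2 ⟨σ, rfl⟩, σ x, rfl⟩

theorem mem_map_sign {σ : ℕ → Bool} {l : Literal} :
    l ∈ s.map (fun x => (x, σ x)) ↔ l.1 ∈ s ∧ σ l.1 = l.2 := by
  rw [List.mem_map]
  exact ⟨by rintro ⟨x, hx, rfl⟩; exact ⟨hx, rfl⟩, fun h => ⟨l.1, h.1, Prod.ext rfl h.2⟩⟩

theorem Satisfies.eliminate {τ : ℕ → Bool} (hs : s.Nodup) (hF : Satisfies τ F) :
    Satisfies τ (eliminate F s (signPatterns s)) := by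
  intro D hD
  obtain ⟨C, hC, hCD⟩ := (mem_eliminate.1 hD).2 _ ((mem_signPatterns hs).2 ⟨fun x => !τ x, rfl⟩)
  obtain ⟨l, hl, hτl⟩ := hF C hC
  refine ⟨l, (hCD l hl).resolve_left fun hla => ?_, hτl⟩
  simpa [hτl] using (mem_map_sign.1 hla).2

theorem exists_falsified_of_mem_signPatterns (hs : s.Nodup) (hF : ¬ Satisfiable F) (τ : ℕ → Bool)
    {a : Clause} (ha : a ∈ signPatterns s) :
    ∃ C ∈ F, ∀ l ∈ C, (l.1 ∈ s → l ∈ a) ∧ (l.1 ∉ s → τ l.1 ≠ l.2) := by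
  obtain ⟨σ, rfl⟩ := (mem_signPatterns hs).1 ha
  by_contra! h
  refine hF ⟨fun x => if x ∈ s then !σ x else τ x, fun C hC => ?_⟩
  obtain ⟨l, hl, hls⟩ := h C hC
  refine ⟨l, hl, ?_⟩
  rw [mem_map_sign] at hls
  by_cases hmem : l.1 ∈ s
  · have hne : l.2 ≠ σ l.1 := fun h => (hls fun _ => ⟨hmem, h.symm⟩).1 hmem
    exact (if_pos hmem).trans (Bool.eq_not_of_ne hne).symm
  · exact (if_neg hmem).trans (hls fun h => absurd h hmem).2

/-- If no assignment to `s` extends the assignment `τ` of the other variables to a satisfying one,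
each clause that is falsified by such an extension touches `s`, or else it would survive the
elimination. As these clauses are ordered by inclusion outside `s`, the rest of the greatest one
survives the elimination and is falsified by `τ`. -/
theorem satisfiable_of_satisfiable_eliminate (hs : s.Nodup)
    (hchain : IsChain (· ⊆ ·) ((fun e : Set ℕ => e \ {x | x ∈ s}) ''
      incidentEdges (formulaHypergraph F) {x | x ∈ s}))
    (h : Satisfiable (eliminate F s (signPatterns s))) : Satisfiable F := by
  obtain ⟨τ, hτ⟩ := h
  by_contra hF
  choose C hCF hC using fun a : {a // a ∈ signPatterns s} =>
    exists_falsified_of_mem_signPatterns hs hF τ a.2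
  have hnotMem b : (C b).filter (fun l => !s.contains l.1) ∉ eliminate F s (signPatterns s) := by
    intro hD
    obtain ⟨l, hl, hτl⟩ := hτ _ hD
    simp only [List.mem_filter, Bool.not_eq_true', List.contains_eq_mem,
      decide_eq_false_iff_not] at hl
    exact (hC b l hl.1).2 hl.2 hτl
  have htouches b : touches (C b) s = true := by
    by_contra ht
    rw [touches_iff] at ht
    refine hnotMem b (mem_eliminate.2 ⟨⟨C b, hCF b, rfl⟩, fun a _ => ⟨C b, hCF b, fun l hl => ?_⟩⟩)
    exact .inr (List.mem_filter.2 ⟨hl, by simpa using fun h => ht ⟨l.1, h, l, hl, rfl⟩⟩)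
  have : Finite {a // a ∈ signPatterns s} := List.finite_toSet _
  have : Nonempty {a // a ∈ signPatterns s} := ⟨_, (mem_signPatterns hs).2 ⟨fun _ => true, rfl⟩⟩
  obtain ⟨b, hb⟩ : ∃ b, ∀ a, clauseVars (C a) \ {x | x ∈ s} ⊆ clauseVars (C b) \ {x | x ∈ s} := by
    refine Directed.finite_le (fun a a' => ?_) id
    have hincident a := clauseVars_mem_incidentEdges (hCF a) (htouches a)
    rcases hchain.total ⟨_, hincident a, rfl⟩ ⟨_, hincident a', rfl⟩ with h | h
    exacts [⟨a', h, subset_rfl⟩, ⟨a, subset_rfl, h⟩]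
  refine hnotMem b (mem_eliminate.2 ⟨⟨C b, hCF b, rfl⟩, fun a ha => ⟨C ⟨a, ha⟩, hCF _, ?_⟩⟩)
  intro l hl
  by_cases hls : l.1 ∈ s
  · exact .inl ((hC ⟨a, ha⟩ l hl).1 hls)
  · obtain ⟨⟨l', hl', hll'⟩, -⟩ := hb ⟨a, ha⟩ ⟨⟨l, hl, rfl⟩, hls⟩
    have hτl := (hC ⟨a, ha⟩ l hl).2 hls
    have hτl' := (hC b l' hl').2 (hll' ▸ hls)
    have : l' = l := Prod.ext hll' <|
      (Bool.eq_not_of_ne hτl'.symm).trans (hll' ▸ (Bool.eq_not_of_ne hτl.symm).symm)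
    exact .inr (List.mem_filter.2 ⟨this ▸ hl', by simpa using hls⟩)

theorem satisfiable_eliminate_iff (hs : s.Nodup) (hconflicts : conflicts F s = []) :
    Satisfiable (eliminate F s (signPatterns s)) ↔ Satisfiable F :=
  ⟨satisfiable_of_satisfiable_eliminate hs (isChain_of_conflicts_eq_nil hconflicts),
    fun ⟨τ, hτ⟩ => ⟨τ, hτ.eliminate hs⟩⟩

theorem satisfiable_iff_of_hasVar_eq_false (h : hasVar F = false) :
    Satisfiable F ↔ F.isEmpty = true := by
  rw [List.isEmpty_iff]
  refine ⟨fun ⟨τ, hτ⟩ => List.eq_nil_iff_forall_not_mem.2 fun C hC => ?_, ?_⟩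
  · obtain ⟨l, hl, -⟩ := hτ C hC
    exact Bool.false_ne_true (h.symm.trans (hasVar_iff.2 ⟨l.1, C, hC, l, hl, rfl⟩))
  · rintro rfl
    exact ⟨fun _ => true, by simp [Satisfies]⟩

end Elimination

section Correctness

open Function TreeEncoding
open scoped Hypergraph

variable {F : CNF} {k K L x : ℕ} {c : Candidate}

/-- The candidates that occur while nest-sets of size `k` of `F` are searched for. -/
structure Candidate.IsValid (F : CNF) (k : ℕ) (c : Candidate) : Prop where
  nodup : c.vars.Nodup
  mem : ∀ x ∈ c.vars, x ∈ V(formulaHypergraph F)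
  budget : c.budget.length + c.vars.length = k + 1
  patterns_eq : c.patterns = signPatterns c.vars

namespace Candidate

theorem IsValid.extend (h : c.IsValid F k) (hc : c.budget ≠ [])
    (hxF : x ∈ V(formulaHypergraph F)) (hx : x ∉ c.vars) : (c.extend x).IsValid F k where
  nodup := List.nodup_cons.2 ⟨hx, h.nodup⟩
  mem := List.forall_mem_cons.2 ⟨hxF, h.mem⟩
  budget := by
    have := List.length_pos_iff.2 hc
    have := h.budget
    simp only [Candidate.extend, List.length_tail, List.length_cons]
    omega
  patterns_eq := congrArg (List.flatMap _) h.patterns_eq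

theorem isValid_of_mem_singletons {u : List Unit} (hc : c ∈ singletons F u) :
    c.IsValid F u.length := by
  obtain ⟨x, hx, rfl⟩ := List.mem_map.1 hc
  have hempty : Candidate.IsValid F u.length ⟨() :: u, [], [[]]⟩ :=
    ⟨List.nodup_nil, fun x hx => absurd hx List.not_mem_nil, rfl, rfl⟩
  exact hempty.extend (List.cons_ne_nil _ _) (mem_vertexSet_iff.2 hx) List.not_mem_nil

theorem IsValid.exists_notMem {S : Set ℕ} (h : c.IsValid F k) (hc : c.budget = [])
    (hS : S.encard ≤ k) : ∃ x ∈ c.vars, x ∉ S := by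
  by_contra! hsub
  have hcard : (c.vars.toFinset : Set ℕ).encard ≤ k :=
    (Set.encard_le_encard fun x hx => hsub x (List.mem_toFinset.1 hx)).trans hS
  rw [Set.encard_coe_eq_coe_finsetCard, List.toFinset_card_of_nodup h.nodup, Nat.cast_le] at hcard
  have := h.budget
  rw [hc, List.length_nil] at this
  omega

end Candidate

/-- The invariant of the search, for an input `F₀` of nest-set width at most `K`. -/
structure SearchState.Invariant (K : ℕ) (F₀ : CNF) (q : SearchState) : Prop where
  hasKNEO : HasKNEO (formulaHypergraph q.formula) K
  width_le : q.width.length ≤ K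
  valid : ∀ c ∈ q.queue, c.IsValid q.formula q.width.length ∧ c.vars ≠ []
  search : V(formulaHypergraph q.formula).Nonempty → q.width.length = K →
    ∃ S, IsNestSet (formulaHypergraph q.formula) S ∧ S.encard ≤ K ∧
      ∃ c ∈ q.queue, ∀ x ∈ c.vars, x ∈ S
  size_le : encodeSize q.formula ≤ encodeSize F₀
  satisfiable_iff : Satisfiable q.formula ↔ Satisfiable F₀

/-- A bound for the number of remaining steps of the search in a formula of size at most `L` and
nest-set width at most `K`. For each of the remaining pairs of a number of variables and a width
there are at most `L` binary trees of candidates of height at most `K`, and one further step. -/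
noncomputable def SearchState.potential (K L : ℕ) (q : SearchState) : ℕ :=
  (V(formulaHypergraph q.formula).ncard * (K + 1) + (K - q.width.length)) * (L * 3 ^ K + 1) +
    (q.queue.map fun c => 3 ^ c.budget.length).sum

theorem length_occurrences_le (F : CNF) : (occurrences F).length ≤ encodeSize F := by
  induction F with
  | nil => exact Nat.zero_le _
  | cons C F ih =>
    have := length_lt_encodeSize C
    simp only [occurrences, List.flatMap_cons, List.length_append, List.length_map,
      encodeSize_cons] at ih ⊢
    omega

theorem ncard_vertexSet_le (F : CNF) : V(formulaHypergraph F).ncard ≤ encodeSize F := by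
  have hV : V(formulaHypergraph F) = (occurrences F).toFinset :=
    Set.ext fun x => by rw [mem_vertexSet_iff, List.coe_toFinset, Set.mem_ofPred_eq]
  rw [hV, Set.ncard_coe_finset]
  exact (List.toFinset_card_le _).trans (length_occurrences_le F)

theorem encodeSize_le_of_mem_vertexSet (hx : x ∈ V(formulaHypergraph F)) :
    encodeSize x ≤ encodeSize F := by
  obtain ⟨C, hC, l, hl, rfl⟩ := hx
  have hlx : encodeSize l = encodeSize l.1 + encodeSize l.2 + 1 := encodeSize_pair l.1 l.2
  have := encodeSize_lt_of_mem hl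
  have := encodeSize_lt_of_mem hC
  omega

theorem encodeSize_filter_le {α : Type} [TreeEncoding α] (p : α → Bool) (l : List α) :
    encodeSize (l.filter p) ≤ encodeSize l := by
  induction l with
  | nil => rfl
  | cons a l ih =>
    rw [List.filter_cons]
    split <;> simp only [encodeSize_cons] <;> omega

theorem encodeSize_eliminate_le (F : CNF) (s : List ℕ) (A : List Clause) :
    encodeSize (eliminate F s A) ≤ encodeSize F := by
  refine (encodeSize_filter_le _ _).trans ?_
  induction F with
  | nil => rfl
  | cons C F ih =>
    have := encodeSize_filter_le (fun l : Literal => !s.contains l.1) C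
    rw [List.map_cons, encodeSize_cons, encodeSize_cons]
    omega

namespace SearchState

variable {F₀ : CNF} {q : SearchState} {queue : List Candidate}

theorem invariant_init (h : HasKNEO (formulaHypergraph F) K) : Invariant K F ⟨F, [], []⟩ where
  hasKNEO := h
  width_le := Nat.zero_le _
  valid _ hc := absurd hc List.not_mem_nil
  search hV hK := absurd hK (h.pos hV).ne
  size_le := le_rfl
  satisfiable_iff := Iff.rfl

theorem Invariant.width_lt (h : q.Invariant K F₀) (hV : V(formulaHypergraph q.formula).Nonempty)
    (hqueue : q.queue = []) : q.width.length < K := by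
  refine h.width_le.lt_of_ne fun hK => ?_
  obtain ⟨S, -, -, c, hc, -⟩ := h.search hV hK
  rw [hqueue] at hc
  exact List.not_mem_nil hc

theorem Invariant.enlarge (h : q.Invariant K F₀) (hK : q.width.length < K) :
    Invariant K F₀ ⟨q.formula, () :: q.width, singletons q.formula (() :: q.width)⟩ where
  hasKNEO := h.hasKNEO
  width_le := hK
  valid c hc := by
    refine ⟨Candidate.isValid_of_mem_singletons hc, ?_⟩
    obtain ⟨x, -, rfl⟩ := List.mem_map.1 hc
    exact List.cons_ne_nil _ _
  search hV _ := by
    obtain ⟨S, hS, hSK⟩ := h.hasKNEO.exists_isNestSet hV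
    obtain ⟨x, hx⟩ := hS.1
    exact ⟨S, hS, hSK, _, List.mem_map_of_mem (mem_vertexSet_iff.1 (hS.2.1 hx)),
      List.forall_mem_singleton.2 hx⟩
  size_le := h.size_le
  satisfiable_iff := h.satisfiable_iff

theorem potential_enlarge_lt (hL : encodeSize q.formula ≤ L) (hK : q.width.length < K) :
    potential K L ⟨q.formula, () :: q.width, singletons q.formula (() :: q.width)⟩ <
      potential K L q := by
  have hsum : ((singletons q.formula (() :: q.width)).map fun c => 3 ^ c.budget.length).sum ≤
      L * 3 ^ K := by
    refine (List.sum_le_card_nsmul _ (3 ^ K) fun m hm => ?_).trans ?_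
    · obtain ⟨c, hc, rfl⟩ := List.mem_map.1 hm
      obtain ⟨x, -, rfl⟩ := List.mem_map.1 hc
      exact Nat.pow_le_pow_right three_pos hK
    · rw [singletons, List.length_map, List.length_map, smul_eq_mul]
      exact Nat.mul_le_mul_right _ ((length_occurrences_le _).trans hL)
  have hwidth : K - q.width.length = K - (q.width.length + 1) + 1 := by omega
  simp only [potential, List.length_cons, hwidth, ← add_assoc, add_one_mul (_ + (_ - _))]
  omega

theorem Invariant.discard (h : q.Invariant K F₀) (hqueue : q.queue = c :: queue)
    (hc : c.budget = []) : Invariant K F₀ ⟨q.formula, q.width, queue⟩ where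
  hasKNEO := h.hasKNEO
  width_le := h.width_le
  valid c' hc' := h.valid c' (hqueue ▸ List.mem_cons_of_mem _ hc')
  search hV hK := by
    obtain ⟨S, hS, hSK, c', hc', hcS⟩ := h.search hV hK
    refine ⟨S, hS, hSK, c', (List.mem_cons.1 (hqueue ▸ hc')).resolve_left ?_, hcS⟩
    rintro rfl
    obtain ⟨x, hx, hxS⟩ := (h.valid c' hc').1.exists_notMem hc (hK ▸ hSK)
    exact hxS (hcS x hx)
  size_le := h.size_le
  satisfiable_iff := h.satisfiable_iff

theorem Invariant.eliminate (h : q.Invariant K F₀) (hc : c ∈ q.queue)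
    (hconflicts : conflicts q.formula c.vars = []) :
    Invariant K F₀ ⟨eliminate q.formula c.vars c.patterns, [], []⟩ := by
  have hvalid := (h.valid c hc).1
  have hinit := invariant_init
    ((isPartialTrace_eliminate q.formula c.vars c.patterns).hasKNEO h.hasKNEO)
  refine { hinit with
    size_le := (encodeSize_eliminate_le _ _ _).trans h.size_le
    satisfiable_iff := ?_ }
  rw [← h.satisfiable_iff, ← satisfiable_eliminate_iff hvalid.nodup hconflicts,
    hvalid.patterns_eq]

theorem Invariant.potential_eliminate_lt (h : q.Invariant K F₀) (hc : c ∈ q.queue) :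
    potential K L ⟨NestSetSAT.eliminate q.formula c.vars c.patterns, [], []⟩ <
      potential K L q := by
  obtain ⟨hvalid, hne⟩ := h.valid c hc
  obtain ⟨x, hx⟩ := List.exists_mem_of_ne_nil _ hne
  have hcard := Nat.mul_le_mul_right (K + 1) (Nat.succ_le_of_lt
    (ncard_vertexSet_eliminate_lt (A := c.patterns) hx (hvalid.mem x hx)))
  refine (Nat.mul_lt_mul_of_pos_right ?_ (Nat.succ_pos _)).trans_le (Nat.le_add_right _ _)
  simp only [List.length_nil]
  grind

theorem Invariant.branch (h : q.Invariant K F₀) (hqueue : q.queue = c :: queue)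
    (hc : c.budget ≠ []) {p : ℕ × ℕ} (hp : p ∈ conflicts q.formula c.vars) :
    Invariant K F₀ ⟨q.formula, q.width, c.extend p.1 :: c.extend p.2 :: queue⟩ where
  hasKNEO := h.hasKNEO
  width_le := h.width_le
  valid := by
    obtain ⟨⟨h₁, h₁'⟩, h₂, h₂'⟩ := mem_vertexSet_of_mem_conflicts hp
    have hvalid := h.valid
    simp only [hqueue, List.forall_mem_cons] at hvalid ⊢
    exact ⟨⟨hvalid.1.1.extend hc h₁ h₁', List.cons_ne_nil _ _⟩,
      ⟨hvalid.1.1.extend hc h₂ h₂', List.cons_ne_nil _ _⟩, hvalid.2⟩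
  search hV hK := by
    obtain ⟨S, hS, hSK, c', hc', hcS⟩ := h.search hV hK
    refine ⟨S, hS, hSK, ?_⟩
    simp only [hqueue, List.mem_cons] at hc'
    simp only [List.exists_mem_cons_iff, Candidate.extend, List.forall_mem_cons]
    rcases hc' with rfl | hc'
    · exact (hS.mem_or_mem_of_mem_conflicts hcS hp).imp (⟨·, hcS⟩) fun hpS => .inl ⟨hpS, hcS⟩
    · exact .inr (.inr ⟨c', hc', hcS⟩)
  size_le := h.size_le
  satisfiable_iff := h.satisfiable_iff

theorem potential_branch_lt (hqueue : q.queue = c :: queue) (hc : c.budget ≠ []) (x y : ℕ) :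
    potential K L ⟨q.formula, q.width, c.extend x :: c.extend y :: queue⟩ < potential K L q := by
  obtain ⟨u, b, hb⟩ := List.exists_cons_of_ne_nil hc
  have : 0 < 3 ^ b.length := by positivity
  simp only [potential, hqueue, Candidate.extend, hb, List.tail_cons, List.map_cons, List.sum_cons,
    List.length_cons, pow_succ]
  omega

theorem Invariant.step (h : q.Invariant K F₀) (hq : hasVar q.formula = true) :
    (step q).Invariant K F₀ ∧
      (NestSetSAT.step q).potential K (encodeSize F₀) < q.potential K (encodeSize F₀) := by
  rw [hasVar_iff] at hq
  rcases hqueue : q.queue with _ | ⟨c, queue⟩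
  · simp only [NestSetSAT.step, hqueue, caseList_nil]
    have hK := h.width_lt hq hqueue
    exact ⟨h.enlarge hK, potential_enlarge_lt h.size_le hK⟩
  by_cases hc : c.budget = []
  · simp only [NestSetSAT.step, hqueue, caseList_cons, hc, List.isEmpty_nil, cond_true]
    refine ⟨h.discard hqueue hc, Nat.add_lt_add_left ?_ _⟩
    simp only [hqueue, List.map_cons, List.sum_cons]
    exact Nat.lt_add_of_pos_left (by positivity)
  have hcq : c ∈ q.queue := hqueue ▸ List.mem_cons_self
  simp only [NestSetSAT.step, hqueue, caseList_cons, List.isEmpty_eq_false_iff.2 hc, cond_false,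
    examine]
  rcases hconflicts : conflicts q.formula c.vars with _ | ⟨p, l⟩
  · exact ⟨h.eliminate hcq hconflicts, h.potential_eliminate_lt hcq⟩
  · exact ⟨h.branch hqueue hc (hconflicts ▸ List.mem_cons_self), potential_branch_lt hqueue hc _ _⟩

end SearchState

end Correctness

section SizeBounds

open Function TreeEncoding
open scoped Hypergraph

variable {K L : ℕ}

theorem exists_iterate_eq_false {α : Type*} {f : α → α} {test : α → Bool} {I : α → Prop} {φ : α → ℕ}
    (h : ∀ a, I a → test a = true → I (f a) ∧ φ (f a) < φ a) (a : α) (ha : I a) :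
    ∃ N ≤ φ a, (∀ n < N, test (f^[n] a) = true) ∧ test (f^[N] a) = false ∧
      ∀ n ≤ N, I (f^[n] a) ∧ φ (f^[n] a) ≤ φ a := by
  induction hφ : φ a using Nat.strong_induction_on generalizing a with
  | _ k ih =>
    subst hφ
    cases htest : test a with
    | false =>
      refine ⟨0, Nat.zero_le _, fun n hn => absurd hn n.not_lt_zero, htest, fun n hn => ?_⟩
      rw [Nat.le_zero.1 hn]
      exact ⟨ha, le_rfl⟩
    | true =>
      obtain ⟨hI, hφ⟩ := h a ha htest
      obtain ⟨N, hN, hlt, hend, hle⟩ := ih _ hφ _ hI rfl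
      refine ⟨N + 1, hN.trans_lt hφ, fun n hn => ?_, hend, fun n hn => ?_⟩
      · cases n with
        | zero => exact htest
        | succ n => exact hlt n (Nat.lt_of_succ_lt_succ hn)
      · cases n with
        | zero => exact ⟨ha, le_rfl⟩
        | succ n =>
          obtain ⟨hI', hφ'⟩ := hle n (Nat.le_of_succ_le_succ hn)
          exact ⟨hI', hφ'.trans hφ.le⟩

theorem encodeSize_list_le_of_length_le {α : Type} [TreeEncoding α] {l : List α} {n B : ℕ}
    (hl : l.length ≤ n) (h : ∀ a ∈ l, encodeSize a ≤ B) : encodeSize l ≤ n * (B + 1) + 1 :=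
  (encodeSize_list_le h).trans (Nat.succ_le_succ (Nat.mul_le_mul_right _ hl))

theorem encodeSize_unary_le {u : List Unit} {n : ℕ} (hu : u.length ≤ n) :
    encodeSize u ≤ 2 * n + 1 :=
  (encodeSize_list_le_of_length_le hu fun _ _ => le_rfl).trans (by rw [mul_comm])

/-- A bound for the sizes of the candidates that occur in the search in a formula of size at most
`L` and nest-set width at most `K`. -/
def Candidate.sizeBound (K L : ℕ) : ℕ :=
  (2 * (K + 1) + 1) + ((K + 1) * (L + 1) + 1) +
    (2 ^ (K + 1) * ((K + 1) * (L + 5) + 1 + 1) + 1) + 2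

theorem Candidate.IsValid.encodeSize_le {F : CNF} {k : ℕ} {c : Candidate} (h : c.IsValid F k)
    (hk : k ≤ K) (hL : encodeSize F ≤ L) : encodeSize c ≤ sizeBound K L := by
  have hlen := h.budget
  have hvars : c.vars.length ≤ K + 1 := by omega
  have hbudget : encodeSize c.budget ≤ 2 * (K + 1) + 1 := encodeSize_unary_le (by omega)
  have hvar (x) (hx : x ∈ c.vars) : encodeSize x ≤ L :=
    (encodeSize_le_of_mem_vertexSet (h.mem x hx)).trans hL
  have hpattern (a) (ha : a ∈ c.patterns) : encodeSize a ≤ (K + 1) * (L + 5) + 1 := by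
    rw [h.patterns_eq, mem_signPatterns h.nodup] at ha
    obtain ⟨σ, rfl⟩ := ha
    refine encodeSize_list_le_of_length_le (List.length_map _ |>.trans_le hvars) fun l hl => ?_
    obtain ⟨x, hx, rfl⟩ := List.mem_map.1 hl
    have := hvar x hx
    have := encodeSize_bool_le (σ x)
    rw [encodeSize_pair]
    omega
  have hpatterns : c.patterns.length ≤ 2 ^ (K + 1) := by
    rw [h.patterns_eq, length_signPatterns]
    exact Nat.pow_le_pow_right two_pos hvars
  have := encodeSize_list_le_of_length_le hvars hvar
  have := encodeSize_list_le_of_length_le hpatterns hpattern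
  rw [encodeSize_eq, sizeBound]
  omega

theorem SearchState.length_queue_le_potential (q : SearchState) :
    q.queue.length ≤ q.potential K L := by
  have hsum := List.card_nsmul_le_sum (q.queue.map fun c => 3 ^ c.budget.length) 1 fun m hm => by
    obtain ⟨c, -, rfl⟩ := List.mem_map.1 hm
    exact Nat.one_le_pow _ _ three_pos
  rw [List.length_map, smul_eq_mul, mul_one] at hsum
  exact hsum.trans (Nat.le_add_left _ _)

/-- A bound for the sizes of the states that occur in the search in a formula of size at most `L`
and nest-set width at most `K`, while there are at most `n` remaining steps. -/
def SearchState.sizeBound (K L n : ℕ) : ℕ :=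
  L + (2 * K + 1) + (n * (Candidate.sizeBound K L + 1) + 1) + 2

theorem SearchState.Invariant.encodeSize_le {F₀ : CNF} {q : SearchState} {n : ℕ}
    (h : q.Invariant K F₀) (hn : q.potential K (encodeSize F₀) ≤ n) :
    encodeSize q ≤ sizeBound K (encodeSize F₀) n := by
  have hformula := h.size_le
  have hwidth := encodeSize_unary_le h.width_le
  have hqueue := encodeSize_list_le_of_length_le (q.length_queue_le_potential.trans hn)
    fun c hc => (h.valid c hc).1.encodeSize_le h.width_le h.size_le
  rw [encodeSize_eq, sizeBound]
  omega

end SizeBounds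

section InputOutput

open Turing Function TreeEncoding
open scoped BinaryTree

instance : DecidableEq Symbol := symbolValue_injective.decidableEq

/-- Pop a symbol of the input into its register. -/
def popInput : StackProg := .pop .input fun v x => { v with read := x }

/-- Add the symbol that was read last, if it occurs in the given list, to the list of symbols whose
code is on the value stack. -/
def consRead : List Symbol → StackProg
  | [] => .load id
  | a :: l => .ite (fun v => v.read == some a) (pushWord .value (some true :: word (encode a)))
      (consRead l)

theorem run_popInput (I O W v) : Run popInput v (allStacks I O W) 1 { v with read := I.head? }
    (allStacks I.tail O W) := by
  have := Run.pop (Γ := Alphabet) .input (fun (v : Memory) x => { v with read := x }) v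
    (allStacks I O W)
  rwa [update_allStacks_input] at this

theorem run_consRead (I : List Symbol) {a : Symbol} {as w : List Symbol} {v : Memory}
    (ha : a ∈ as) (hv : v.read = some a) : ∃ n ≤ as.length + 11,
      Run (consRead as) v (allStacks I [] (workStacks (word (encode w)) [] [] [])) n v
        (allStacks I [] (workStacks (word (encode (a :: w))) [] [] [])) := by
  induction as with
  | nil => exact absurd ha List.not_mem_nil
  | cons b as ih =>
    by_cases hab : a = b
    · subst hab
      have hsize : (word (encode a)).length ≤ 9 := encodeSize_symbol_le a
      refine ⟨_, ?_, .ite_true (by simp [hv]) (run_pushWord .value v _ ?_)⟩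
      · simp only [List.length_cons]
        omega
      · exact (update_workStacks_value ..).symm
    · obtain ⟨n, hn, run⟩ := ih ((List.mem_cons.1 ha).resolve_left hab)
      exact ⟨n + 1, Nat.succ_le_succ hn, .ite_false (by simp [hv, hab]) run⟩

/-- Replace the input by the tree of the reversed list of its symbols as the current value. -/
noncomputable def readInput : StackProg :=
  pushWord .value [some false] ;;
    whileProg popInput (fun v => v.read.isSome) (consRead Finset.univ.toList)

theorem run_readInput (w : List Symbol) (v : Memory) : ∃ n ≤ 18 * w.length + 4, ∃ v',
    Run readInput v (allStacks w [] (workStacks [] [] [] [])) n v'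
      (allStacks [] [] (workStacks (word (encode w.reverse)) [] [] [])) := by
  have hloop (w w' : List Symbol) (v : Memory) : ∃ n ≤ 18 * w.length + 2, ∃ v',
      Run (whileProg popInput (fun v => v.read.isSome) (consRead Finset.univ.toList)) v
        (allStacks w [] (workStacks (word (encode w')) [] [] [])) n v'
        (allStacks [] [] (workStacks (word (encode (w.reverse ++ w'))) [] [] [])) := by
    induction w generalizing w' v with
    | nil => exact ⟨2, le_rfl, _, .while_done (run_popInput ..) rfl⟩
    | cons a w ih =>
      obtain ⟨n, hn, cons⟩ := run_consRead w (w := w') (v := { v with read := some a })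
        (Finset.mem_toList.2 (Finset.mem_univ a)) rfl
      obtain ⟨m, hm, v', run⟩ := ih (a :: w') { v with read := some a }
      rw [Finset.length_toList, Finset.card_univ, show Fintype.card Symbol = 5 from rfl] at hn
      rw [List.reverse_cons, List.append_assoc]
      refine ⟨_, ?_, v', .while_step (run_popInput ..) rfl cons run⟩
      rw [List.length_cons]
      omega
  have hnil : Run (pushWord .value [some false]) v (allStacks w [] (workStacks [] [] [] [])) 2 v
      (allStacks w [] (workStacks (word (encode ([] : List Symbol))) [] [] [])) :=
    run_pushWord .value v _ (update_workStacks_value ..).symm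
  obtain ⟨n, hn, v', run⟩ := hloop w [] v
  rw [List.append_nil] at run
  exact ⟨_, by omega, v', .seq hnil run⟩

/-- Move the truth value that is the current value to the output, and reset the memory. Its code
has at most three symbols. -/
def writeOutput : StackProg :=
  popFirst .value ;; .push .output isNode ;; popFirst .value ;; popFirst .value ;;
    .load fun _ => {}

theorem run_writeOutput (b : Bool) (v : Memory) :
    Run writeOutput v (allStacks [] [] (workStacks (word (encode b)) [] [] [])) 5 {}
      (allStacks [] [b] (workStacks [] [] [] [])) := by
  have pop (O l v) : Run (popFirst .value) v (allStacks [] O (workStacks l [] [] [])) 1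
      { v with first := l.head? } (allStacks [] O (workStacks l.tail [] [] [])) :=
    run_popFirst .value v (update_workStacks_value ..).symm
  have push (W v) : Run (.push .output isNode) v (allStacks [] [] W) 1 v
      (allStacks [] [isNode v] W) := by
    have := Run.push (Γ := Alphabet) .output isNode v (allStacks [] [] W)
    rwa [update_allStacks_output] at this
  have run := Run.seq (pop _ (word (encode b)) v) (.seq (push _ _) (.seq (pop _ _ _) (.seq
    (pop _ _ _) (.load (fun _ => {}) _ _))))
  cases b <;> exact run

/-- The Turing machine that uses `p` to decide a property of words. -/
noncomputable abbrev decider (p : StackProg) : FinTM2 :=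
  Prog.machine (Γ := Alphabet) StackName.input StackName.output ({} : Memory)
    (readInput ;; p ;; writeOutput)

theorem outputsInTime_of_computes {p : StackProg} {w : List Symbol} {b : Bool} {n m : ℕ}
    (h : Computes p (encode w.reverse) (encode b) n) (hm : 18 * w.length + n + 9 ≤ m) :
    Nonempty (TM2OutputsInTime (decider p) w (some [b]) m) := by
  obtain ⟨k, hk, v, run⟩ := run_readInput w {}
  obtain ⟨l, hl, v', run'⟩ := h [] v
  have hempty : allStacks [] [] (workStacks [] [] [] []) = fun _ => [] := by
    funext i
    rcases i with _ | _ | (_ | _ | _ | _) <;> rfl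
  have total := run.seq (run'.seq (run_writeOutput b v'))
  have hinput := update_allStacks_input [] [] (workStacks [] [] [] []) w
  have houtput := update_allStacks_output [] [] (workStacks [] [] [] []) [b]
  rw [hempty] at hinput houtput
  rw [← hinput, ← houtput] at total
  exact total.outputsInTime (by omega)

end InputOutput

section Tractability

open Function TreeEncoding
open scoped Hypergraph

theorem encodeSize_le_length_encodeCNF (F : CNF) :
    encodeSize F ≤ 6 * (encodeCNF F).length + 1 := by
  have hbits (x : ℕ) : encodeSize x ≤ 4 * x.bits.length + 1 :=
    (encodeSize_list_le fun b _ => encodeSize_bool_le b).trans (by rw [mul_comm])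
  have hliteral (l : Literal) : encodeSize l + 1 ≤ 6 * (encodeLiteral l).length := by
    have := hbits l.1
    have := encodeSize_bool_le l.2
    have : encodeSize l = encodeSize l.1 + encodeSize l.2 + 1 := encodeSize_pair l.1 l.2
    rw [encodeLiteral, List.length_cons, List.length_map]
    omega
  have hclause (C : Clause) : encodeSize C ≤ 6 * (C.flatMap encodeLiteral).length + 1 := by
    induction C with
    | nil => exact le_rfl
    | cons l C ih =>
      have := hliteral l
      rw [List.flatMap_cons, List.length_append, encodeSize_cons]
      omega
  induction F with
  | nil => exact le_rfl
  | cons C F ih =>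
    have := hclause C
    rw [encodeCNF, List.flatMap_cons, ← encodeCNF, encodeClause, encodeSize_cons,
      List.length_append, List.length_append, List.length_singleton]
    omega

/-- The quantity in which sizes and running times are polynomially bounded. The power of four
bounds the numbers of sign patterns and of candidates. -/
noncomputable def complexity (F : CNF) : ℕ :=
  4 ^ (formulaWidth F + 1) * ((encodeCNF F).length + 1)

theorem polyBounded_of_le_four_pow {b : CNF → ℕ} (hb : ∀ F, b F ≤ 4 ^ (formulaWidth F + 1)) :
    PolyBounded complexity b :=
  PolyBounded.self.mono fun F => (hb F).trans (Nat.le_mul_of_pos_right _ (Nat.succ_pos _))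

theorem polyBounded_formulaWidth : PolyBounded complexity formulaWidth :=
  polyBounded_of_le_four_pow fun _ => (Nat.lt_succ_self _).le.trans (Nat.lt_pow_self (by omega)).le

theorem polyBounded_length : PolyBounded complexity fun F => (encodeCNF F).length :=
  PolyBounded.self.mono fun _ =>
    (Nat.le_succ _).trans (Nat.le_mul_of_pos_left _ (Nat.pow_pos four_pos))

theorem polyBounded_encodeSize : PolyBounded complexity fun F => encodeSize F :=
  (((PolyBounded.const 6).mul polyBounded_length).add (.const 1)).mono
    encodeSize_le_length_encodeCNF

theorem polyBounded_encodeSize_word :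
    PolyBounded complexity fun F => encodeSize (encodeCNF F).reverse :=
  ((polyBounded_length.mul (.const (9 + 1))).add (.const 1)).mono fun F => by
    rw [encodeSize_reverse]
    exact encodeSize_list_le fun a _ => encodeSize_symbol_le a

/-- A bound for the number of steps of the search in the formula `F`. -/
noncomputable def searchTime (F : CNF) : ℕ :=
  SearchState.potential (formulaWidth F) (encodeSize F) ⟨F, [], []⟩

theorem polyBounded_searchTime : PolyBounded complexity searchTime := by
  have hpow : PolyBounded complexity fun F => 3 ^ formulaWidth F :=
    polyBounded_of_le_four_pow fun F => (Nat.pow_le_pow_left (by omega) _).trans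
      (Nat.pow_le_pow_right four_pos (Nat.le_succ _))
  have hV : PolyBounded complexity fun F => V(formulaHypergraph F).ncard :=
    polyBounded_encodeSize.mono ncard_vertexSet_le
  exact ((hV.mul (polyBounded_formulaWidth.add (.const 1))).add polyBounded_formulaWidth).mul
    ((polyBounded_encodeSize.mul hpow).add (.const 1))

theorem polyBounded_candidateSizeBound :
    PolyBounded complexity fun F => Candidate.sizeBound (formulaWidth F) (encodeSize F) := by
  have hpow : PolyBounded complexity fun F => 2 ^ (formulaWidth F + 1) :=
    polyBounded_of_le_four_pow fun F => Nat.pow_le_pow_left (by omega) _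
  have hK := polyBounded_formulaWidth.add (.const 1)
  have hL (n : ℕ) := polyBounded_encodeSize.add (.const n)
  exact (((((PolyBounded.const 2).mul hK).add (.const 1)).add ((hK.mul (hL 1)).add (.const 1))).add
    ((hpow.mul (((hK.mul (hL 5)).add (.const 1)).add (.const 1))).add (.const 1))).add (.const 2)

theorem polyBounded_stateSizeBound : PolyBounded complexity fun F =>
    SearchState.sizeBound (formulaWidth F) (encodeSize F) (searchTime F) :=
  ((polyBounded_encodeSize.add
    (((PolyBounded.const 2).mul polyBounded_formulaWidth).add (.const 1))).add
      ((polyBounded_searchTime.mul (polyBounded_candidateSizeBound.add (.const 1))).add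
        (.const 1))).add (.const 2)

theorem exists_search (F : CNF) : ∃ N ≤ searchTime F,
    (∀ n < N, hasVar (step^[n] ⟨F, [], []⟩).formula = true) ∧
    (∀ n ≤ N, encodeSize (step^[n] ⟨F, [], []⟩) ≤
      SearchState.sizeBound (formulaWidth F) (encodeSize F) (searchTime F)) ∧
    hasVar (step^[N] ⟨F, [], []⟩).formula = false ∧
    ((step^[N] ⟨F, [], []⟩).formula.isEmpty = true ↔ Satisfiable F) := by
  obtain ⟨N, hN, hlt, hend, hle⟩ := exists_iterate_eq_false
    (test := fun q : SearchState => hasVar q.formula) (fun _ h => h.step) _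
    (SearchState.invariant_init (hasKNEO_nestSetWidth (finite_vertexSet F)))
  refine ⟨N, hN, hlt, fun n hn => (hle n hn).1.encodeSize_le (hle n hn).2, hend, ?_⟩
  rw [← satisfiable_iff_of_hasVar_eq_false hend]
  exact (hle N le_rfl).1.satisfiable_iff

theorem exists_computableWithin_satisfiable : ∃ answer : CNF → Bool,
    (∀ F, answer F = true ↔ Satisfiable F) ∧
    ComputableWithin complexity (fun F => encode (encodeCNF F).reverse)
      fun F => encode (answer F) := by
  choose N hN hlt hsize hend hanswer using exists_search
  have hparse : ComputableWithin complexity (fun F => encode (encodeCNF F).reverse)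
      fun F => encode F :=
    (polyTime_parse.within _ polyBounded_encodeSize_word).congr fun F => by rw [parse_encodeCNF]
  have hinit : PolyTime fun F : CNF => SearchState.mk F [] [] := by fun_prop
  have hsearch : ComputableWithin complexity (fun F => encode (SearchState.mk F [] []))
      fun F => encode (step^[N F] ⟨F, [], []⟩) :=
    PolyTime.iterate polyTime_step (test := fun q => hasVar q.formula) (by fun_prop)
      (polyBounded_searchTime.mono hN) polyBounded_stateSizeBound hsize hlt hend
  have houtput : PolyTime fun q : SearchState => q.formula.isEmpty := by fun_prop
  exact ⟨_, hanswer, hparse.trans ((hinit.within _ polyBounded_encodeSize).trans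
    (hsearch.trans (houtput.within _ hsearch.1)))⟩

theorem computable_four_pow_add_two_pow (d : ℕ) :
    Computable fun k : ℕ => (4 ^ (k + 1) + 2) ^ d := by
  have hpow : Primrec₂ fun m n : ℕ => m ^ n := Primrec₂.unpaired'.1 Nat.Primrec.pow
  exact (hpow.comp (Primrec.nat_add.comp (hpow.comp (.const 4) .succ) (.const 2))
    (.const d)).to_comp

end Tractability

end NestSetSAT

open NestSetSAT

theorem theorem5p13 :
    NestSetSAT.IsFixedParameterTractable
      NestSetSAT.encodeCNF NestSetSAT.Satisfiable NestSetSAT.formulaWidth := by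
  obtain ⟨answer, hanswer, -, p, b, hb, hp⟩ := exists_computableWithin_satisfiable
  obtain ⟨d, hd⟩ := (((PolyBounded.const 18).mul polyBounded_length).add hb).add (.const 9)
  refine ⟨⟨decider p, Equiv.refl Symbol, Equiv.refl Bool⟩, fun k => (4 ^ (k + 1) + 2) ^ d, d,
    computable_four_pow_add_two_pow d, fun F => ⟨answer F, hanswer F, ?_⟩⟩
  have htime : 18 * (encodeCNF F).length + b F + 9 ≤
      (4 ^ (formulaWidth F + 1) + 2) ^ d * ((encodeCNF F).length + 1) ^ d := by
    rw [← mul_pow]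
    refine (hd F).trans (Nat.pow_le_pow_left ?_ _)
    rw [complexity, add_mul]
    omega
  have hinput : (encodeCNF F).map (Equiv.refl Symbol).symm = encodeCNF F := List.map_id _
  exact hinput.symm ▸ outputsInTime_of_computes (hp F) htime
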